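/- Consider the standard asynchronous shared-memory model: $n$ deterministic processes $p_1,\dots,p_n$ (with distinct identifiers, which the algorithm may use) communicate by atomically reading and writing multi-writer multi-reader registers of unbounded size. Each step of a process is the invocation of an operation, a read or a write of one register, a local computation, or the response of an operation. A process is active while an operation invoked on it has not yet responded, and idle otherwise; operations are invoked only on idle processes, with arbitrary arguments and at arbitrary times, and local states persist from one operation to the next. An execution is a finite or infinite sequence of steps that starts in the initial configuration and respects the algorithm. A process is correct in an execution if it takes infinitely many steps or is idle from some point on. Let $D$ be any set of input values. An algorithm that implements operations $\mathrm{Propose}(v)$, $v\in D$, with responses in $D$, solves repeated $k$-set agreement if in every execution $\alpha$ and for every $i\ge 1$, with $In_i(\alpha)$ the set of arguments of the $i$th invocations of $\mathrm{Propose}$ by the processes and $Out_i(\alpha)$ the set of responses of their $i$th $\mathrm{Propose}$ operations, - (validity) $Out_i(\alpha)\subseteq In_i(\alpha)$, and - ($k$-agreement) $|Out_i(\alpha)|\le k$. It is $m$-obstruction-free if in every execution in which at most $m$ processes take infinitely many steps, every correct process completes each of its operations. **Theorem.** For all integers $1\le m\le k<n$ and every $D$, there is an $m$-obstruction-free algorithm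 that solves repeated $k$-set agreement among $n$ processes using $\min(n+2m-k,\,n)$ registers. -/

import Mathlib

universe u

namespace SharedMemory

/-- What an active process with a given local state does in its next step: read a register
(the new local state depends on the value read), write a register, compute locally, or produce
the response of its current operation. -/
inductive Action (r : ℕ) (D Val Loc : Type u) : Type u
  | read (i : Fin r) (next : Val → Loc)
  | write (i : Fin r) (x : Val) (next : Loc)
  | compute (next : Loc)
  | respond (d : D) (next : Loc)

/-- A deterministic algorithm for `n` asynchronous processes, with identifiers in `Fin n`, that
communicate through `r` multi-writer multi-reader registers and implement an operation
`Propose(v)`, `v ∈ D`, with responses in `D`. Registers and local states may be unbounded. -/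
structure Algorithm (n r : ℕ) (D : Type u) where
  /-- register values -/
  Val : Type u
  /-- local states of the processes; they persist from one operation to the next -/
  Loc : Type u
  initReg : Fin r → Val
  initLoc : Fin n → Loc
  /-- local state of an idle process after `Propose(v)` has been invoked on it -/
  onInvoke : Fin n → Loc → D → Loc
  /-- the unique next step of an active process -/
  next : Fin n → Loc → Action r D Val Loc

/-- The steps of processes as they are recorded in an execution; `internal p` is a read, a write
or a local computation of `p`. -/
inductive Event (n : ℕ) (D : Type u) : Type u
  | invoke (p : Fin n) (v : D)
  | internal (p : Fin n)
  | respond (p : Fin n) (d : D)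

/-- The process that performs a step. -/
def Event.proc {n : ℕ} {D : Type u} : Event n D → Fin n
  | .invoke p _ => p
  | .internal p => p
  | .respond p _ => p

variable {n r : ℕ} {D : Type u}

/-- A configuration: contents of the registers, local states of the processes, and which
processes are active (as opposed to idle). -/
structure Config (A : Algorithm n r D) where
  reg : Fin r → A.Val
  loc : Fin n → A.Loc
  active : Fin n → Bool

def Config.init (A : Algorithm n r D) : Config A where
  reg := A.initReg
  loc := A.initLoc
  active := fun _ => false

/-- `Step c e c'`: the step `e` respects the algorithm and leads from `c` to `c'`. -/
inductive Step {A : Algorithm n r D} : Config A → Event n D → Config A → Prop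
  | invoke (c : Config A) (p : Fin n) (v : D) (hp : c.active p = false) :
      Step c (.invoke p v)
        { reg := c.reg
          loc := Function.update c.loc p (A.onInvoke p (c.loc p) v)
          active := Function.update c.active p true }
  | read (c : Config A) (p : Fin n) (i : Fin r) (f : A.Val → A.Loc) (hp : c.active p = true)
      (h : A.next p (c.loc p) = .read i f) :
      Step c (.internal p)
        { reg := c.reg
          loc := Function.update c.loc p (f (c.reg i))
          active := c.active }
  | write (c : Config A) (p : Fin n) (i : Fin r) (x : A.Val) (l : A.Loc)
      (hp : c.active p = true) (h : A.next p (c.loc p) = .write i x l) :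
      Step c (.internal p)
        { reg := Function.update c.reg i x
          loc := Function.update c.loc p l
          active := c.active }
  | compute (c : Config A) (p : Fin n) (l : A.Loc) (hp : c.active p = true)
      (h : A.next p (c.loc p) = .compute l) :
      Step c (.internal p)
        { reg := c.reg
          loc := Function.update c.loc p l
          active := c.active }
  | respond (c : Config A) (p : Fin n) (d : D) (l : A.Loc) (hp : c.active p = true)
      (h : A.next p (c.loc p) = .respond d l) :
      Step c (.respond p d)
        { reg := c.reg
          loc := Function.update c.loc p l
          active := Function.update c.active p false }

/-- A finite or infinite execution: `len` is its number of steps, the step `ev t` (for `t < len`)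
leads from the configuration `conf t` to `conf (t + 1)`. The values of `ev` at `t ≥ len` and of
`conf` at `t > len` carry no meaning. -/
structure Execution (A : Algorithm n r D) where
  len : ℕ∞
  conf : ℕ → Config A
  ev : ℕ → Event n D
  start : conf 0 = Config.init A
  step : ∀ t : ℕ, (t : ℕ∞) < len → Step (conf t) (ev t) (conf (t + 1))

namespace Execution

variable {A : Algorithm n r D}

/-- The number of invocations on `p` among the first `t` steps (used for `t ≤ len`). -/
noncomputable def numInvoked (α : Execution A) (p : Fin n) (t : ℕ) : ℕ :=
  {s : ℕ | s < t ∧ ∃ v, α.ev s = .invoke p v}.ncard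

/-- The arguments of the `i`th invocations of `Propose` (`i = 1, 2, …`) of all processes. -/
def inputs (α : Execution A) (i : ℕ) : Set D :=
  {v | ∃ (p : Fin n) (t : ℕ), (t : ℕ∞) < α.len ∧ α.ev t = .invoke p v ∧
    α.numInvoked p t + 1 = i}

/-- The responses of the `i`th `Propose` operations (`i = 1, 2, …`) of all processes. A response
of `p` belongs to the operation that was last invoked on `p`. -/
def outputs (α : Execution A) (i : ℕ) : Set D :=
  {d | ∃ (p : Fin n) (t : ℕ), (t : ℕ∞) < α.len ∧ α.ev t = .respond p d ∧
    α.numInvoked p t = i}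

def TakesInfinitelyManySteps (α : Execution A) (p : Fin n) : Prop :=
  ∀ T : ℕ, ∃ t : ℕ, T ≤ t ∧ (t : ℕ∞) < α.len ∧ (α.ev t).proc = p

def EventuallyIdle (α : Execution A) (p : Fin n) : Prop :=
  ∃ T : ℕ, (T : ℕ∞) ≤ α.len ∧
    ∀ t : ℕ, T ≤ t → (t : ℕ∞) ≤ α.len → (α.conf t).active p = false

def Correct (α : Execution A) (p : Fin n) : Prop :=
  α.TakesInfinitelyManySteps p ∨ α.EventuallyIdle p

/-- Every invocation on `p` is followed by a response of `p`. (No operation can be invoked on an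
active process, so the first such response is the matching one.) -/
def CompletesAll (α : Execution A) (p : Fin n) : Prop :=
  ∀ (t : ℕ) (v : D), (t : ℕ∞) < α.len → α.ev t = .invoke p v →
    ∃ (t' : ℕ) (d : D), t < t' ∧ (t' : ℕ∞) < α.len ∧ α.ev t' = .respond p d

end Execution

/-- Validity and `k`-agreement, for every instance in every execution. -/
def Algorithm.SolvesRepeatedSetAgreement (A : Algorithm n r D) (k : ℕ) : Prop :=
  ∀ α : Execution A, ∀ i : ℕ, 1 ≤ i →
    α.outputs i ⊆ α.inputs i ∧ (α.outputs i).encard ≤ k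

def Algorithm.ObstructionFree (A : Algorithm n r D) (m : ℕ) : Prop :=
  ∀ α : Execution A, {p : Fin n | α.TakesInfinitelyManySteps p}.encard ≤ m →
    ∀ p : Fin n, α.Correct p → α.CompletesAll p

end SharedMemory

/-! The algorithm works with `r = n + 2m - k` components. If `r ≤ n`, each component has its own
register. Otherwise `n` registers suffice: each process keeps its cells for all components in a
register of its own, and the cell with the largest stamp counts. Stamps are unique, so two equal
collects give the contents of the registers at one moment (`exists_snapshot`). Registers also carry
the known decisions, so a scan that ends in instance `i` has seen no cell of a later instance
(`cell_inst_le`).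

Agreement (`dec_encard_le`). Suppose more than `k` processes decide in instance `i` by a snapshot.
Let `T` be the first time by which `k - m + 1` of their deciding snapshots have been taken. The
snapshots strictly before `T` account for at most `k - m` values. At `T` all components belong to
instance `i` and hold at most `m` tuples, and at most `n - (k - m + 1)` processes can still write in
instances up to `i`. It remains to see that later decisions use values present at `T`. The invariant
`Uniform` says that the components written since `T` by one of these processes either all hold one
tuple with a present value, or there is at most one of them. Since `m + (n - (k - m + 1)) < r`, the
pigeonhole principle gives two components with the same tuple of instance `i`, and by the invariant
every such duplicated value is present at `T`. Hence a process with another value finds its tuple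
nowhere but at its position, sees a duplicated value, and adopts one instead of advancing. This
preserves the invariant (`Window.invariant`).

Termination (`Live.not_stuckFrom`). Let at most `m` processes be live and one of them be stuck. Then
all are stuck (`exists_stuckFrom`): if one completed operations forever, some late instance would be
decided while all components belong to it, and since `m < r` a register with decisions of all
earlier instances would be safe from the slower processes, so that the stuck process would find its
decision there. Once all live processes are stuck, no writer can advance its position forever: all
components would be rewritten, each writer would account for at most one tuple, and a writer in the
least instance would decide (`pos_eventually_const`). Nor can all writers stay where they are: then
every scan ends with an adoption, but a duplicated value remains duplicated, so a process that has
adopted it has no reason to adopt again (`not_pos_const`). -/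

namespace SharedMemory
namespace SetAgreement

/-! ### The algorithm. -/

/-- What a process announces: its identifier, the number of its current operation, and its
preferred value. -/
structure Tuple (n : ℕ) (D : Type u) : Type u where
  id : Fin n
  inst : ℕ
  val : D

/-- Content of a component of the simulated snapshot object. Stamps are unique; the initial cell
has stamp `0`. -/
structure Cell (n : ℕ) (D : Type u) : Type u where
  stamp : ℕ
  tup : Option (Tuple n D)

/-- Content of a register: the writer's cells, the decisions it knows, the stamp of the write. -/
structure RegVal (n r : ℕ) (D : Type u) : Type u where
  arr : Fin r → Cell n D
  hist : List D
  stamp : ℕ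

def Cell.empty (n : ℕ) (D : Type u) : Cell n D := ⟨0, none⟩

def RegVal.empty (n r : ℕ) (D : Type u) : RegVal n r D := ⟨fun _ => Cell.empty n D, [], 0⟩

/-- An undecided process is about to write, or it collects the registers twice: `k` is the number
of reads made so far, `buf` the values obtained by the first collect. -/
inductive Phase (n ρ r : ℕ) (D : Type u) : Type u
  | write
  | scan (buf : Fin ρ → RegVal n r D) (k : ℕ)

structure State (n ρ r : ℕ) (D : Type u) : Type u where
  arr : Fin r → Cell n D
  stamp : ℕ
  /-- known decisions of the instances `1, 2, …` -/
  hist : List D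
  /-- number of operations invoked so far -/
  inst : ℕ
  /-- the component that the process works on -/
  pos : Fin r
  pref : D
  phase : Phase n ρ r D

/-- How `r` components are stored in `ρ` registers: `target p j` is the register that `p` writes
in order to update component `j`, and `pick j f` is the register whose cell counts as the content
of component `j`, if `f x` is the cell for `j` in register `x`. -/
structure Layout (n ρ r : ℕ) (D : Type u) where
  target : Fin n → Fin r → Fin ρ
  pick : Fin r → (Fin ρ → Cell n D) → Fin ρ

variable {n ρ r : ℕ} {D : Type u}

def Layout.view (L : Layout n ρ r D) (regs : Fin ρ → RegVal n r D) (j : Fin r) : Cell n D :=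
  (regs (L.pick j fun x => (regs x).arr j)).arr j

/-- Each component has a register of its own. -/
def Layout.IsDirect (L : Layout n ρ r D) : Prop :=
  ∃ e : Fin r → Fin ρ, Function.Injective e ∧ (∀ p j, L.target p j = e j) ∧ ∀ j f, L.pick j f = e j

/-- Each process has a register of its own, and the cell with the largest stamp counts. -/
def Layout.IsOwn (L : Layout n ρ r D) : Prop :=
  ∃ e : Fin n → Fin ρ, Function.Bijective e ∧ (∀ p j, L.target p j = e p) ∧
    ∀ j (f : Fin ρ → Cell n D) x, (f x).stamp ≤ (f (L.pick j f)).stamp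

/-- The values of the tuples of instance `t` that occur in two components. -/
def dupSet (v : Fin r → Cell n D) (t : ℕ) : Set D :=
  {d | ∃ j₁ j₂ u, j₁ ≠ j₂ ∧ (v j₁).tup = some u ∧ (v j₂).tup = some u ∧ u.inst = t ∧ u.val = d}

namespace State

def Undecided (s : State n ρ r D) : Prop := s.hist.length < s.inst

def mine (p : Fin n) (s : State n ρ r D) : Tuple n D := ⟨p, s.inst, s.pref⟩

/-- The residue modulo `n` identifies the writer, so different processes never use the same stamp.
The summand `1` makes stamps increase and keeps them apart from the initial stamp `0`. -/
def newStamp (p : Fin n) (s : State n ρ r D) : ℕ := (s.stamp + 1) * n + p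

def newCell (p : Fin n) (s : State n ρ r D) : Cell n D := ⟨newStamp p s, some (mine p s)⟩

def newArr (p : Fin n) (s : State n ρ r D) : Fin r → Cell n D :=
  Function.update s.arr s.pos (newCell p s)

def newVal (p : Fin n) (s : State n ρ r D) : RegVal n r D :=
  ⟨newArr p s, s.hist, newStamp p s⟩

/-- The position survives from one operation to the next; the invariant `Steady` relies on this. -/
def onInvoke (s : State n ρ r D) (v : D) : State n ρ r D :=
  { s with inst := s.inst + 1, pref := v, phase := .write }

def afterWrite (p : Fin n) (s : State n ρ r D) : State n ρ r D :=
  { s with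
    arr := newArr p s, stamp := newStamp p s
    phase := .scan (fun _ => RegVal.empty n r D) 0 }

open Classical in
/-- The effect of reading `v` in register `x`. A decision for the current instance found in `v`
is adopted. -/
noncomputable def afterRead (s : State n ρ r D) (buf : Fin ρ → RegVal n r D) (k : ℕ) (x : Fin ρ)
    (v : RegVal n r D) : State n ρ r D :=
  if s.inst ≤ v.hist.length then { s with hist := v.hist }
  else if k < ρ then { s with phase := .scan (Function.update buf x v) (k + 1) }
  else if buf x = v then { s with phase := .scan buf (k + 1) }
  else { s with phase := .scan buf 0 }

/-- All components belong to instance `t`, and there are at most `m` different tuples. -/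
def Full (m t : ℕ) (v : Fin r → Cell n D) : Prop :=
  (∀ j, ∃ u, (v j).tup = some u ∧ u.inst = t) ∧ (Set.range fun j => (v j).tup).ncard ≤ m

/-- The condition under which `p` changes its preferred value. -/
def Adopts (p : Fin n) (s : State n ρ r D) (v : Fin r → Cell n D) : Prop :=
  (∀ j, j ≠ s.pos → (v j).tup ≠ some (mine p s)) ∧ (dupSet v s.inst).Nonempty ∧
    s.pref ∉ dupSet v s.inst

open Classical in
/-- The effect of a successful double collect with view `v`. -/
noncomputable def afterScan [NeZero r] [Nonempty D] (m : ℕ) (p : Fin n) (s : State n ρ r D)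
    (v : Fin r → Cell n D) : State n ρ r D :=
  if Full m s.inst v then
    { s with
      -- The sum dominates every stamp in the view, so the next write outranks all cells that were
      -- seen.
      stamp := s.stamp + ∑ j, (v j).stamp, phase := .write
      hist := s.hist ++ [Classical.epsilon (· ∈ dupSet v s.inst)] }
  else if Adopts p s v then
    { s with
      stamp := s.stamp + ∑ j, (v j).stamp, phase := .write
      pref := Classical.epsilon (· ∈ dupSet v s.inst) }
  else
    { s with stamp := s.stamp + ∑ j, (v j).stamp, phase := .write, pos := s.pos + 1 }

end State

open State

/-- Reduction modulo `ρ`: the reads `0, …, ρ - 1` form the first collect, `ρ, …, 2ρ - 1` the second.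
-/
def regIndex [NeZero ρ] (k : ℕ) : Fin ρ := Fin.ofNat ρ k

/-- The next step of process `p` in state `s`: respond if the current instance is decided; else
write the current component, or read in the course of a double collect, or evaluate it. -/
noncomputable def nextAction (L : Layout n ρ r D) (m : ℕ) [NeZero ρ] [NeZero r] [Nonempty D]
    (p : Fin n) (s : State n ρ r D) : Action ρ D (RegVal n r D) (State n ρ r D) :=
  -- The default value is never used: an active process has `1 ≤ s.inst`, so the index is in range.
  if s.inst ≤ s.hist.length then .respond (s.hist.getD (s.inst - 1) (Classical.arbitrary D)) s
  else match s.phase with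
    | .write => .write (L.target p s.pos) (newVal p s) (afterWrite p s)
    | .scan buf k =>
      if k < 2 * ρ then .read (regIndex k) (fun v => afterRead s buf k (regIndex k) v)
      else .compute (afterScan m p s (L.view buf))

/-- The algorithm: in each round a process writes its tuple into the current component and takes a
snapshot by a double collect. -/
noncomputable def algorithm (L : Layout n ρ r D) (m : ℕ) [NeZero ρ] [NeZero r] [Nonempty D] :
    Algorithm n ρ D where
  Val := RegVal n r D
  Loc := State n ρ r D
  initReg := fun _ => RegVal.empty n r D
  initLoc := fun _ => ⟨fun _ => Cell.empty n D, 0, [], 0, 0, Classical.arbitrary D, .write⟩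
  onInvoke := fun _ s v => s.onInvoke v
  next := nextAction L m

/-! ### Runs with labelled steps. -/

/-- A step together with what it does in the algorithm; `idle` is a stuttering step. -/
inductive Label (n : ℕ) (D : Type u) : Type u
  | idle
  | invoke (p : Fin n) (v : D)
  | respond (p : Fin n) (d : D)
  | write (p : Fin n)
  | read (p : Fin n)
  | finish (p : Fin n)

def Label.proc : Label n D → Option (Fin n)
  | .idle => none
  | .invoke p _ => some p
  | .respond p _ => some p
  | .write p => some p
  | .read p => some p
  | .finish p => some p

/-- An execution of the algorithm with explicit labels, made infinite by stuttering. -/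
structure Run (L : Layout n ρ r D) (m : ℕ) [NeZero ρ] [NeZero r] [Nonempty D] where
  reg : ℕ → Fin ρ → RegVal n r D
  st : ℕ → Fin n → State n ρ r D
  act : ℕ → Fin n → Bool
  lab : ℕ → Label n D
  reg_zero : reg 0 = fun _ => RegVal.empty n r D
  st_zero : st 0 = fun _ =>
    ⟨fun _ => Cell.empty n D, 0, [], 0, 0, Classical.arbitrary D, .write⟩
  act_zero : act 0 = fun _ => false
  st_frame : ∀ t q, (lab t).proc ≠ some q → st (t + 1) q = st t q
  act_frame : ∀ t q, (lab t).proc ≠ some q → act (t + 1) q = act t q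
  reg_frame : ∀ t, (∀ q, lab t ≠ .write q) → reg (t + 1) = reg t
  invoke : ∀ t q v, lab t = .invoke q v →
    act t q = false ∧ act (t + 1) q = true ∧ st (t + 1) q = (st t q).onInvoke v
  respond : ∀ t q d, lab t = .respond q d →
    act t q = true ∧ act (t + 1) q = false ∧ st (t + 1) q = st t q ∧ ¬ (st t q).Undecided ∧
      d = (st t q).hist.getD ((st t q).inst - 1) (Classical.arbitrary D)
  write : ∀ t q, lab t = .write q →
    act t q = true ∧ act (t + 1) q = true ∧ (st t q).Undecided ∧ (st t q).phase = .write ∧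
      st (t + 1) q = afterWrite q (st t q) ∧
      reg (t + 1) = Function.update (reg t) (L.target q (st t q).pos) (newVal q (st t q))
  read : ∀ t q, lab t = .read q →
    act t q = true ∧ act (t + 1) q = true ∧ (st t q).Undecided ∧
      ∃ buf k, (st t q).phase = .scan buf k ∧ k < 2 * ρ ∧
        st (t + 1) q = afterRead (st t q) buf k (regIndex k) (reg t (regIndex k))
  finish : ∀ t q, lab t = .finish q →
    act t q = true ∧ act (t + 1) q = true ∧ (st t q).Undecided ∧
      ∃ buf k, (st t q).phase = .scan buf k ∧ 2 * ρ ≤ k ∧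
        st (t + 1) q = afterScan m q (st t q) (L.view buf)

section OfExecution

variable {L : Layout n ρ r D} {m : ℕ} [NeZero ρ] [NeZero r] [Nonempty D]

/-- The label `l` describes the step from `c` to `c'`. -/
structure Describes (c c' : Config (algorithm L m)) (l : Label n D) : Prop where
  st_frame : ∀ q, l.proc ≠ some q → c'.loc q = c.loc q
  act_frame : ∀ q, l.proc ≠ some q → c'.active q = c.active q
  reg_frame : (∀ q, l ≠ .write q) → c'.reg = c.reg
  invoke : ∀ q v, l = .invoke q v →
    c.active q = false ∧ c'.active q = true ∧ c'.loc q = State.onInvoke (c.loc q) v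
  respond : ∀ q d, l = .respond q d →
    c.active q = true ∧ c'.active q = false ∧ c'.loc q = c.loc q ∧ ¬ State.Undecided (c.loc q) ∧
      d = (State.hist (c.loc q)).getD (State.inst (c.loc q) - 1) (Classical.arbitrary D)
  write : ∀ q, l = .write q →
    c.active q = true ∧ c'.active q = true ∧ State.Undecided (c.loc q) ∧
      State.phase (c.loc q) = .write ∧ c'.loc q = afterWrite q (c.loc q) ∧
      c'.reg = Function.update c.reg (L.target q (State.pos (c.loc q))) (newVal q (c.loc q))
  read : ∀ q, l = .read q →
    c.active q = true ∧ c'.active q = true ∧ State.Undecided (c.loc q) ∧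
      ∃ buf k, State.phase (c.loc q) = .scan buf k ∧ k < 2 * ρ ∧
        c'.loc q = afterRead (c.loc q) buf k (regIndex k) (c.reg (regIndex k))
  finish : ∀ q, l = .finish q →
    c.active q = true ∧ c'.active q = true ∧ State.Undecided (c.loc q) ∧
      ∃ buf k, State.phase (c.loc q) = .scan buf k ∧ 2 * ρ ≤ k ∧
        c'.loc q = afterScan m q (c.loc q) (L.view buf)

/-- The label has the same visible content as the event. -/
def Label.Matches (l : Label n D) (e : Event n D) : Prop :=
  l.proc = some e.proc ∧ (∀ p v, e = .invoke p v ↔ l = .invoke p v) ∧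
    ∀ p d, e = .respond p d ↔ l = .respond p d

theorem exists_label {c c' : Config (algorithm L m)} {e : Event n D} (h : Step c e c') :
    ∃ l : Label n D, l.Matches e ∧ Describes c c' l := by
  have hne : ∀ {p q : Fin n}, some p ≠ some q → q ≠ p := fun h e => h (e ▸ rfl)
  cases h with
  | invoke p v hp =>
    refine ⟨.invoke p v, ⟨rfl, by simp, by simp⟩, ?_⟩
    refine ⟨fun q hq => Function.update_of_ne (hne hq) _ _,
      fun q hq => Function.update_of_ne (hne hq) _ _, fun _ => rfl, ?_, by simp, by simp, by simp,
      by simp⟩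
    rintro q w ⟨⟩
    exact ⟨hp, Function.update_self .., Function.update_self ..⟩
  | read p i f hp h =>
    have h : nextAction L m p (c.loc p) = .read i f := h
    unfold nextAction at h
    split_ifs at h with h1
    split at h
    · cases h
    next buf k hph =>
    split_ifs at h with h2
    cases h
    refine ⟨.read p, ⟨rfl, by simp, by simp⟩, ?_⟩
    refine ⟨fun q hq => Function.update_of_ne (hne hq) _ _, fun q hq => rfl, fun _ => rfl,
      by simp, by simp, by simp, ?_, by simp⟩
    rintro q ⟨⟩
    exact ⟨hp, hp, not_le.1 h1, buf, k, hph, h2, Function.update_self ..⟩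
  | write p i x l hp h =>
    have h : nextAction L m p (c.loc p) = .write i x l := h
    unfold nextAction at h
    split_ifs at h with h1
    split at h
    swap
    · split_ifs at h
    next hph =>
    cases h
    refine ⟨.write p, ⟨rfl, by simp, by simp⟩, ?_⟩
    refine ⟨fun q hq => Function.update_of_ne (hne hq) _ _, fun q hq => rfl,
      fun hq => absurd rfl (hq p), by simp, by simp, ?_, by simp, by simp⟩
    rintro q ⟨⟩
    exact ⟨hp, hp, not_le.1 h1, hph, Function.update_self .., rfl⟩
  | compute p l hp h =>
    have h : nextAction L m p (c.loc p) = .compute l := h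
    unfold nextAction at h
    split_ifs at h with h1
    split at h
    · cases h
    next buf k hph =>
    split_ifs at h with h2
    cases h
    refine ⟨.finish p, ⟨rfl, by simp, by simp⟩, ?_⟩
    refine ⟨fun q hq => Function.update_of_ne (hne hq) _ _, fun q hq => rfl, fun _ => rfl,
      by simp, by simp, by simp, by simp, ?_⟩
    rintro q ⟨⟩
    exact ⟨hp, hp, not_le.1 h1, buf, k, hph, not_lt.1 h2, Function.update_self ..⟩
  | respond p d l hp h =>
    have h : nextAction L m p (c.loc p) = .respond d l := h
    unfold nextAction at h
    split_ifs at h with h1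
    swap
    · split at h
      · cases h
      · split_ifs at h
    cases h
    refine ⟨.respond p ((State.hist (c.loc p)).getD (State.inst (c.loc p) - 1) (Classical.arbitrary D)),
      ⟨rfl, by simp, by simp⟩, ?_⟩
    refine ⟨fun q hq => Function.update_of_ne (hne hq) _ _,
      fun q hq => Function.update_of_ne (hne hq) _ _, fun _ => rfl, by simp, ?_, by simp, by simp,
      by simp⟩
    rintro q d ⟨⟩
    exact ⟨hp, Function.update_self .., Function.update_self .., not_lt.2 h1, rfl⟩

theorem describes_idle (c : Config (algorithm L m)) : Describes c c .idle := by
  refine ⟨fun _ _ => rfl, fun _ _ => rfl, fun _ => rfl, ?_, ?_, ?_, ?_, ?_⟩ <;> simp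

/-- Every execution of the algorithm is described by a run. -/
theorem exists_run (α : Execution (algorithm L m)) :
    ∃ R : Run L m,
      (∀ t : ℕ, (t : ℕ∞) ≤ α.len → R.act t = (α.conf t).active ∧ R.st t = (α.conf t).loc) ∧
      (∀ t : ℕ, (t : ℕ∞) < α.len → (R.lab t).Matches (α.ev t)) ∧
      ∀ t : ℕ, ¬ (t : ℕ∞) < α.len → R.lab t = .idle := by
  classical
  have key : ∀ t : ℕ, ∃ (l : Label n D), (∀ h : (t : ℕ∞) < α.len, l.Matches (α.ev t) ∧
      Describes (α.conf t) (α.conf (t + 1)) l) ∧ (¬ (t : ℕ∞) < α.len → l = .idle) := by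
    intro t
    by_cases h : (t : ℕ∞) < α.len
    · obtain ⟨l, h1, h2⟩ := exists_label (α.step t h)
      exact ⟨l, fun _ => ⟨h1, h2⟩, fun h' => absurd h h'⟩
    · exact ⟨.idle, fun h' => absurd h' h, fun _ => rfl⟩
  choose lab hlab hidle using key
  -- `idx` stops the clock at the end of a finite execution; from there on the run stutters.
  obtain ⟨idx, hidx0, hidx, hidx1, hidx2⟩ : ∃ idx : ℕ → ℕ, idx 0 = 0 ∧
      (∀ t : ℕ, (t : ℕ∞) ≤ α.len → idx t = t) ∧
      (∀ t : ℕ, (t : ℕ∞) < α.len → idx t = t ∧ idx (t + 1) = t + 1) ∧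
      ∀ t : ℕ, ¬ (t : ℕ∞) < α.len → idx (t + 1) = idx t := by
    cases hl : α.len with
    | top => exact ⟨id, rfl, fun _ _ => rfl, fun _ _ => ⟨rfl, rfl⟩, fun t h => by simp at h⟩
    | coe N =>
      refine ⟨fun t => min t N, by simp, fun t h => ?_, fun t h => ?_, fun t h => ?_⟩ <;>
        simp only [Nat.cast_le, Nat.cast_lt] at h <;> simp only <;> omega
  have hd : ∀ t, Describes (α.conf (idx t)) (α.conf (idx (t + 1))) (lab t) := by
    intro t
    by_cases h : (t : ℕ∞) < α.len
    · rw [(hidx1 t h).1, (hidx1 t h).2]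
      exact (hlab t h).2
    · rw [hidx2 t h, hidle t h]
      exact describes_idle _
  refine ⟨{
    reg := fun t => (α.conf (idx t)).reg
    st := fun t => (α.conf (idx t)).loc
    act := fun t => (α.conf (idx t)).active
    lab := lab
    reg_zero := by simp only [hidx0, α.start]; rfl
    st_zero := by simp only [hidx0, α.start]; rfl
    act_zero := by simp only [hidx0, α.start]; rfl
    st_frame := fun t => (hd t).st_frame
    act_frame := fun t => (hd t).act_frame
    reg_frame := fun t => (hd t).reg_frame
    invoke := fun t => (hd t).invoke
    respond := fun t => (hd t).respond
    write := fun t => (hd t).write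
    read := fun t => (hd t).read
    finish := fun t => (hd t).finish }, fun t ht => ?_, fun t ht => (hlab t ht).1, hidle⟩
  exact ⟨congrArg (fun s => (α.conf s).active) (hidx t ht),
    congrArg (fun s => (α.conf s).loc) (hidx t ht)⟩

end OfExecution

/-! ### The effect of single steps on a local state. -/

section StateLemmas

theorem newStamp_gt (p : Fin n) (s : State n ρ r D) : s.stamp < newStamp p s := by
  have : 1 ≤ n := p.pos
  have : s.stamp + 1 ≤ (s.stamp + 1) * n := Nat.le_mul_of_pos_right _ this
  unfold newStamp
  omega

theorem ofNat_newStamp [NeZero n] (p : Fin n) (s : State n ρ r D) :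
    Fin.ofNat n (newStamp p s) = p := by
  apply Fin.ext
  simp [newStamp, Fin.ofNat, Nat.mod_eq_of_lt p.isLt]

theorem afterRead_eq_or (s : State n ρ r D) (buf : Fin ρ → RegVal n r D) (k : ℕ) (x : Fin ρ)
    (v : RegVal n r D) :
    (s.inst ≤ v.hist.length ∧ afterRead s buf k x v = { s with hist := v.hist }) ∨
      (v.hist.length < s.inst ∧ ((k < ρ ∧
        afterRead s buf k x v = { s with phase := .scan (Function.update buf x v) (k + 1) }) ∨
      (ρ ≤ k ∧ buf x = v ∧ afterRead s buf k x v = { s with phase := .scan buf (k + 1) }) ∨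
      (ρ ≤ k ∧ buf x ≠ v ∧ afterRead s buf k x v = { s with phase := .scan buf 0 }))) := by
  unfold afterRead
  split_ifs with h1 h2 h3
  · exact .inl ⟨h1, rfl⟩
  · exact .inr ⟨not_le.1 h1, .inl ⟨h2, rfl⟩⟩
  · exact .inr ⟨not_le.1 h1, .inr (.inl ⟨not_lt.1 h2, h3, rfl⟩)⟩
  · exact .inr ⟨not_le.1 h1, .inr (.inr ⟨not_lt.1 h2, h3, rfl⟩)⟩

/-- A read changes the decisions only, or the phase only. -/
theorem afterRead_fields (s : State n ρ r D) (buf : Fin ρ → RegVal n r D) (k : ℕ) (x : Fin ρ)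
    (v : RegVal n r D) :
    (afterRead s buf k x v).arr = s.arr ∧ (afterRead s buf k x v).stamp = s.stamp ∧
      (afterRead s buf k x v).inst = s.inst ∧ (afterRead s buf k x v).pos = s.pos ∧
      (afterRead s buf k x v).pref = s.pref ∧
      ((afterRead s buf k x v).hist = s.hist ∨
        s.inst ≤ v.hist.length ∧ (afterRead s buf k x v).hist = v.hist) := by
  unfold afterRead
  split_ifs with h1 h2 h3
  · exact ⟨rfl, rfl, rfl, rfl, rfl, .inr ⟨h1, rfl⟩⟩
  all_goals exact ⟨rfl, rfl, rfl, rfl, rfl, .inl rfl⟩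

/-- Pigeonhole: `r` components with at most `m < r` tuples. Hence the value chosen in a decision is
a genuine duplicate. -/
theorem State.Full.dupSet_nonempty {m t : ℕ} {v : Fin r → Cell n D} (h : Full m t v) (hm : m < r) :
    (dupSet v t).Nonempty := by
  have : ¬ Function.Injective fun j => (v j).tup := by
    intro hi
    have h1 := h.2
    rw [Set.ncard_range_of_injective hi] at h1
    simp at h1
    omega
  simp only [Function.Injective, not_forall] at this
  obtain ⟨j₁, j₂, h12, hne⟩ := this
  obtain ⟨u, hu, hut⟩ := h.1 j₁
  exact ⟨u.val, j₁, j₂, u, hne, hu, h12 ▸ hu, hut, rfl⟩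

variable [NeZero r] [Nonempty D]

theorem afterScan_fields (m : ℕ) (p : Fin n) (s : State n ρ r D) (v : Fin r → Cell n D) :
    (afterScan m p s v).arr = s.arr ∧
      (afterScan m p s v).stamp = s.stamp + ∑ j, (v j).stamp ∧
      (afterScan m p s v).inst = s.inst ∧ (afterScan m p s v).phase = .write := by
  unfold afterScan
  split_ifs <;> exact ⟨rfl, rfl, rfl, rfl⟩

theorem afterScan_eq_or (m : ℕ) (p : Fin n) (s : State n ρ r D) (v : Fin r → Cell n D) :
    (Full m s.inst v ∧ (afterScan m p s v).pos = s.pos ∧ (afterScan m p s v).pref = s.pref ∧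
        (afterScan m p s v).hist = s.hist ++ [Classical.epsilon (· ∈ dupSet v s.inst)]) ∨
      (¬ Full m s.inst v ∧ Adopts p s v ∧ (afterScan m p s v).pos = s.pos ∧
        (afterScan m p s v).pref ∈ dupSet v s.inst ∧ (afterScan m p s v).hist = s.hist) ∨
      (¬ Full m s.inst v ∧ ¬ Adopts p s v ∧ (afterScan m p s v).pos = s.pos + 1 ∧
        (afterScan m p s v).pref = s.pref ∧ (afterScan m p s v).hist = s.hist) := by
  unfold afterScan
  split_ifs with h1 h2
  · exact .inl ⟨h1, rfl, rfl, rfl⟩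
  · exact .inr (.inl ⟨h1, h2, rfl, Classical.epsilon_spec h2.2.1, rfl⟩)
  · exact .inr (.inr ⟨h1, h2, rfl, rfl, rfl⟩)

end StateLemmas

/-! ### Monotone quantities, and double collects as atomic snapshots. -/

namespace Run

variable {L : Layout n ρ r D} {m : ℕ} [NeZero ρ] [NeZero r] [Nonempty D] (R : Run L m)

theorem lab_cases (t : ℕ) (q : Fin n) :
    (R.lab t).proc ≠ some q ∨ (∃ v, R.lab t = .invoke q v) ∨ (∃ d, R.lab t = .respond q d) ∨
      R.lab t = .write q ∨ R.lab t = .read q ∨ R.lab t = .finish q := by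
  cases h : R.lab t <;> simp [Label.proc, em']

/-- Activity, number of invocations and known decisions fit together. -/
theorem act_inv (t : ℕ) (q : Fin n) :
    (R.act t q = true → 1 ≤ (R.st t q).inst ∧ (R.st t q).inst ≤ (R.st t q).hist.length + 1) ∧
      (R.act t q = false → (R.st t q).inst ≤ (R.st t q).hist.length) := by
  induction t with
  | zero => simp [R.act_zero, R.st_zero]
  | succ t ih =>
    rcases R.lab_cases t q with h | ⟨v, h⟩ | ⟨d, h⟩ | h | h | h
    · rw [R.st_frame t q h, R.act_frame t q h]; exact ih
    · obtain ⟨h1, h2, h3⟩ := R.invoke t q v h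
      have := ih.2 h1
      simp only [h2, h3, State.onInvoke]
      simp; omega
    · obtain ⟨h1, h2, h3, h4, -⟩ := R.respond t q d h
      simp only [h2, h3]
      simpa [State.Undecided] using h4
    · obtain ⟨h1, h2, h3, h4, h5, -⟩ := R.write t q h
      simp only [h2, h5, State.afterWrite]
      simpa using ih.1 h1
    · obtain ⟨h1, h2, h3, buf, k, h4, h5, h6⟩ := R.read t q h
      obtain ⟨-, -, f1, -, -, f2⟩ := afterRead_fields (R.st t q) buf k (regIndex k)
        (R.reg t (regIndex k))
      rw [h6, h2, f1]
      have := ih.1 h1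
      simp only [State.Undecided] at h3
      rcases f2 with f2 | ⟨f2, f3⟩
      · rw [f2]; simpa using this
      · rw [f3]; simp; omega
    · obtain ⟨h1, h2, h3, buf, k, h4, h5, h6⟩ := R.finish t q h
      obtain ⟨-, -, f1, -⟩ := afterScan_fields m q (R.st t q) (L.view buf)
      have := ih.1 h1
      rw [h6, h2, f1]
      rcases afterScan_eq_or m q (R.st t q) (L.view buf) with f | f | f
      · rw [f.2.2.2]; simp; omega
      · rw [f.2.2.2.2]; simpa using this
      · rw [f.2.2.2.2]; simpa using this

/-- An undecided process knows the decisions of exactly the earlier instances. Therefore a decision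
appended to `hist` lands at the index of the current instance. -/
theorem undecided_length {t : ℕ} {q : Fin n} (h : (R.st t q).Undecided) :
    R.act t q = true ∧ (R.st t q).hist.length + 1 = (R.st t q).inst := by
  have hi := R.act_inv t q
  unfold State.Undecided at h
  cases ha : R.act t q with
  | true => have := hi.1 ha; exact ⟨rfl, by omega⟩
  | false => have := hi.2 ha; omega

theorem mono_succ (t : ℕ) (q : Fin n) :
    (R.st t q).inst ≤ (R.st (t + 1) q).inst ∧
      (R.st t q).hist.length ≤ (R.st (t + 1) q).hist.length ∧
      (R.st t q).stamp ≤ (R.st (t + 1) q).stamp := by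
  rcases R.lab_cases t q with h | ⟨v, h⟩ | ⟨d, h⟩ | h | h | h
  · rw [R.st_frame t q h]; simp
  · obtain ⟨h1, h2, h3⟩ := R.invoke t q v h
    simp [h3, State.onInvoke]
  · obtain ⟨h1, h2, h3, h4, -⟩ := R.respond t q d h
    simp [h3]
  · obtain ⟨h1, h2, h3, h4, h5, -⟩ := R.write t q h
    simpa [h5, State.afterWrite] using (newStamp_gt q (R.st t q)).le
  · obtain ⟨h1, h2, h3, buf, k, h4, h5, h6⟩ := R.read t q h
    obtain ⟨-, f0, f1, -, -, f2⟩ := afterRead_fields (R.st t q) buf k (regIndex k)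
      (R.reg t (regIndex k))
    rw [h6, f0, f1]
    simp only [State.Undecided] at h3
    rcases f2 with f2 | ⟨f2, f3⟩
    · rw [f2]; simp
    · rw [f3]; simp; omega
  · obtain ⟨h1, h2, h3, buf, k, h4, h5, h6⟩ := R.finish t q h
    obtain ⟨-, f0, f1, -⟩ := afterScan_fields m q (R.st t q) (L.view buf)
    rw [h6, f0, f1]
    rcases afterScan_eq_or m q (R.st t q) (L.view buf) with f | f | f
    · rw [f.2.2.2]; simp
    · rw [f.2.2.2.2]; simp
    · rw [f.2.2.2.2]; simp

theorem inst_mono (q : Fin n) : Monotone fun t => (R.st t q).inst :=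
  monotone_nat_of_le_succ fun t => (R.mono_succ t q).1

theorem length_mono (q : Fin n) : Monotone fun t => (R.st t q).hist.length :=
  monotone_nat_of_le_succ fun t => (R.mono_succ t q).2.1

theorem stamp_mono (q : Fin n) : Monotone fun t => (R.st t q).stamp :=
  monotone_nat_of_le_succ fun t => (R.mono_succ t q).2.2

/-- A register is constant over a period, or its last change was by a write in that period. -/
theorem reg_const_or (T t : ℕ) (hT : T ≤ t) (x : Fin ρ) :
    (∀ s, T ≤ s → s ≤ t → R.reg s x = R.reg T x) ∨
      ∃ w q, T ≤ w ∧ w < t ∧ R.lab w = .write q ∧ R.reg t x = newVal q (R.st w q) := by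
  induction t, hT using Nat.le_induction with
  | base => exact .inl fun s h1 h2 => by rw [le_antisymm h2 h1]
  | succ t hT ih =>
    by_cases hw : ∃ q, R.lab t = .write q ∧ L.target q (R.st t q).pos = x
    · obtain ⟨q, hq, hx⟩ := hw
      obtain ⟨-, -, -, -, -, h⟩ := R.write t q hq
      exact .inr ⟨t, q, hT, t.lt_succ_self, hq, by rw [h, ← hx, Function.update_self]⟩
    · have hsame : R.reg (t + 1) x = R.reg t x := by
        by_cases hq : ∃ q, R.lab t = .write q
        · obtain ⟨q, hq⟩ := hq
          obtain ⟨-, -, -, -, -, h⟩ := R.write t q hq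
          rw [h, Function.update_of_ne]
          rintro rfl
          exact hw ⟨q, hq, rfl⟩
        · rw [R.reg_frame t (not_exists.1 hq)]
      rcases ih with ih | ⟨w, q, h1, h2, h3, h4⟩
      · left
        intro s h1 h2
        rcases Nat.lt_or_ge t s with h | h
        · rw [le_antisymm h2 h, hsame, ih t hT le_rfl]
        · exact ih s h1 h
      · exact .inr ⟨w, q, h1, by omega, h3, hsame ▸ h4⟩

/-- The stamp of a register is at most the one that its writer used last. -/
theorem reg_stamp_le [NeZero n] (t : ℕ) (x : Fin ρ) :
    (R.reg t x).stamp ≤ (R.st t (Fin.ofNat n (R.reg t x).stamp)).stamp := by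
  rcases R.reg_const_or 0 t (Nat.zero_le _) x with h | ⟨w, q, h1, h2, h3, h4⟩
  · rw [h t (Nat.zero_le _) le_rfl, R.reg_zero]; simp [RegVal.empty]
  · obtain ⟨-, -, -, -, h5, -⟩ := R.write w q h3
    rw [h4]
    simp only [newVal, ofNat_newStamp]
    refine le_trans ?_ (R.stamp_mono q (show w + 1 ≤ t from h2))
    simp [h5, State.afterWrite]

/-- If a register has the same value at two times, it has that value in between. -/
theorem reg_eq_between [NeZero n] {t₁ s t₂ : ℕ} (h1 : t₁ ≤ s) (h2 : s ≤ t₂) {x : Fin ρ}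
    (h : R.reg t₁ x = R.reg t₂ x) : R.reg s x = R.reg t₁ x := by
  rcases R.reg_const_or t₁ t₂ (h1.trans h2) x with hc | ⟨w, q, hw1, hw2, hw3, hw4⟩
  · exact hc s h1 h2
  -- A write in between carries a stamp larger than any its writer had used by `t₁`, so its value
  -- cannot have been in the register at `t₁`.
  · exfalso
    have h3 := R.reg_stamp_le t₁ x
    rw [h, hw4] at h3
    simp only [newVal, ofNat_newStamp] at h3
    have := R.stamp_mono q hw1
    have := newStamp_gt q (R.st w q)
    simp only at *
    omega

/-- `q` is scanning during the whole period from `a` to `t`, in the same round. -/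
def Scanning (q : Fin n) (a t : ℕ) : Prop :=
  ∀ s, a ≤ s → s ≤ t → (∃ b k, (R.st s q).phase = .scan b k) ∧ (R.st s q).Undecided ∧
    (R.st s q).inst = (R.st t q).inst ∧ (R.st s q).pos = (R.st t q).pos ∧
    (R.st s q).pref = (R.st t q).pref

variable {R} in
theorem Scanning.not_write {q : Fin n} {a t s : ℕ} (h : R.Scanning q a t) (h1 : a ≤ s)
    (h2 : s ≤ t) : R.lab s ≠ .write q := by
  intro hw
  obtain ⟨-, -, -, h3, -⟩ := R.write s q hw
  obtain ⟨⟨b, k, h4⟩, -⟩ := h s h1 h2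
  rw [h3] at h4
  cases h4

variable {R} in
theorem Scanning.succ {q : Fin n} {a t : ℕ} (h : R.Scanning q a t)
    (h1 : ∃ b k, (R.st (t + 1) q).phase = .scan b k) (h2 : (R.st (t + 1) q).Undecided)
    (h3 : (R.st (t + 1) q).inst = (R.st t q).inst) (h4 : (R.st (t + 1) q).pos = (R.st t q).pos)
    (h5 : (R.st (t + 1) q).pref = (R.st t q).pref) : R.Scanning q a (t + 1) := by
  intro s hs1 hs2
  rcases Nat.lt_or_ge t s with hs | hs
  · rw [le_antisymm hs2 hs]; exact ⟨h1, h2, rfl, rfl, rfl⟩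
  · rw [h3, h4, h5]; exact h s hs1 hs

/-- What is known about the values that a scanning process has collected. -/
theorem scan_inv (t : ℕ) (q : Fin n) (buf : Fin ρ → RegVal n r D) (k : ℕ)
    (hu : (R.st t q).Undecided) (hp : (R.st t q).phase = .scan buf k) :
    ∃ a ≤ t, R.Scanning q a t ∧
      (∀ x : Fin ρ, x.val < k → (buf x).hist.length < (R.st t q).inst) ∧
      (∀ x : Fin ρ, x.val < k → ∃ t₁, a ≤ t₁ ∧ t₁ ≤ t ∧ R.reg t₁ x = buf x) ∧
      (ρ ≤ k → ∃ τ, a ≤ τ ∧ τ ≤ t ∧ (∀ x, ∃ t₁, t₁ ≤ τ ∧ R.reg t₁ x = buf x) ∧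
        ∀ x : Fin ρ, x.val + ρ < k → ∃ t₂, τ ≤ t₂ ∧ t₂ ≤ t ∧ R.reg t₂ x = buf x) := by
  have hρ : 0 < ρ := Nat.pos_of_ne_zero (NeZero.ne ρ)
  induction t generalizing buf k with
  | zero => simp [R.st_zero] at hp
  | succ t ih =>
    rcases R.lab_cases t q with h | ⟨v, h⟩ | ⟨d, h⟩ | h | h | h
    · have hs := R.st_frame t q h
      rw [hs] at hu hp
      obtain ⟨a, ha, h1, h2, h3, h4⟩ := ih buf k hu hp
      refine ⟨a, by omega, h1.succ ⟨buf, k, hs ▸ hp⟩ (hs ▸ hu) (by rw [hs]) (by rw [hs])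
        (by rw [hs]), by rwa [hs], fun x hx => ?_, fun hk => ?_⟩
      · obtain ⟨t₁, e1, e2, e3⟩ := h3 x hx
        exact ⟨t₁, e1, by omega, e3⟩
      · obtain ⟨τ, e1, e2, e3, e4⟩ := h4 hk
        refine ⟨τ, e1, by omega, e3, fun x hx => ?_⟩
        obtain ⟨t₂, e1, e2, e3⟩ := e4 x hx
        exact ⟨t₂, e1, by omega, e3⟩
    · obtain ⟨h1, h2, h3⟩ := R.invoke t q v h
      rw [h3] at hp
      simp [State.onInvoke] at hp
    · obtain ⟨h1, h2, h3, h4, -⟩ := R.respond t q d h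
      rw [h3] at hu
      exact absurd hu h4
    · obtain ⟨h1, h2, h3, h4, h5, -⟩ := R.write t q h
      rw [h5] at hp
      simp only [State.afterWrite, Phase.scan.injEq] at hp
      obtain ⟨-, rfl⟩ := hp
      -- The scan begins right after the write; nothing has been read yet.
      refine ⟨t + 1, le_rfl, fun s hs1 hs2 => ?_, by simp, by simp, by omega⟩
      rw [le_antisymm hs2 hs1]
      refine ⟨?_, hu, rfl, rfl, rfl⟩
      rw [h5]
      exact ⟨_, _, rfl⟩
    · obtain ⟨h1, h2, h3, buf', k', h4, h5, h6⟩ := R.read t q h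
      obtain ⟨-, -, f1, f2, f3, -⟩ := afterRead_fields (R.st t q) buf' k' (regIndex k')
        (R.reg t (regIndex k'))
      rw [← h6] at f1 f2 f3
      obtain ⟨a, ha, g1, g2, g3, g4⟩ := ih buf' k' h3 h4
      have hsc : R.Scanning q a (t + 1) := g1.succ ⟨buf, k, hp⟩ hu f1 f2 f3
      refine ⟨a, by omega, hsc, ?_⟩
      rcases afterRead_eq_or (R.st t q) buf' k' (regIndex k') (R.reg t (regIndex k')) with
        ⟨e1, e2⟩ | ⟨e0, ⟨e1, e2⟩ | ⟨e1, e2, e3⟩ | ⟨e1, e2, e3⟩⟩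
      · rw [h6, e2] at hu
        simp only [State.Undecided] at hu
        omega
      · rw [h6, e2] at hp
        simp only [Phase.scan.injEq] at hp
        obtain ⟨rfl, rfl⟩ := hp
        have hk : (regIndex k' : Fin ρ).val = k' := Nat.mod_eq_of_lt e1
        have hold : ∀ x : Fin ρ, x.val < k' + 1 → x ≠ regIndex k' → x.val < k' := by
          intro x hx hne
          have : x.val ≠ k' := fun hx' => hne (Fin.ext (hx'.trans hk.symm))
          omega
        have key : ∀ x : Fin ρ, x.val < k' + 1 → ∃ t₁, a ≤ t₁ ∧ t₁ ≤ t ∧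
            R.reg t₁ x = Function.update buf' (regIndex k') (R.reg t (regIndex k')) x := by
          intro x hx
          by_cases hxk : x = regIndex k'
          · subst hxk
            exact ⟨t, ha, le_rfl, by rw [Function.update_self]⟩
          · rw [Function.update_of_ne hxk]
            exact g3 x (hold x hx hxk)
        refine ⟨fun x hx => ?_, fun x hx => ?_, fun hk' => ?_⟩
        · rw [f1]
          by_cases hxk : x = regIndex k'
          · subst hxk
            rwa [Function.update_self]
          · rw [Function.update_of_ne hxk]
            exact g2 x (hold x hx hxk)
        · obtain ⟨t₁, i1, i2, i3⟩ := key x hx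
          exact ⟨t₁, i1, by omega, i3⟩
        -- This read completes the first collect. Its time serves as `τ`: the first collect lies
        -- before it, the second after it.
        · refine ⟨t, ha, by omega, fun x => ?_, fun x hx => by omega⟩
          obtain ⟨t₁, i1, i2, i3⟩ := key x (by omega)
          exact ⟨t₁, i2, i3⟩
      · rw [h6, e3] at hp
        simp only [Phase.scan.injEq] at hp
        obtain ⟨rfl, rfl⟩ := hp
        refine ⟨fun x hx => ?_, fun x hx => ?_, fun hk' => ?_⟩
        · rw [f1]; exact g2 x (by omega)
        · obtain ⟨t₁, i1, i2, i3⟩ := g3 x (by omega)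
          exact ⟨t₁, i1, by omega, i3⟩
        · obtain ⟨τ, i1, i2, i3, i4⟩ := g4 e1
          refine ⟨τ, i1, by omega, i3, fun x hx => ?_⟩
          by_cases hxk : x = regIndex k'
          · subst hxk
            exact ⟨t, i2, by omega, e2.symm⟩
          · have : x.val + ρ ≠ k' := by
              rintro hx'
              apply hxk
              apply Fin.ext
              simp [regIndex, Fin.ofNat, ← hx', Nat.mod_eq_of_lt x.isLt]
            obtain ⟨t₂, l1, l2, l3⟩ := i4 x (by omega)
            exact ⟨t₂, l1, by omega, l3⟩
      -- After a mismatch the counter restarts at `0`, and all claims about `buf` become vacuous.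
      · rw [h6, e3] at hp
        simp only [Phase.scan.injEq] at hp
        obtain ⟨rfl, rfl⟩ := hp
        exact ⟨by simp, by simp, by omega⟩
    · obtain ⟨h1, h2, h3, buf, k, h4, h5, h6⟩ := R.finish t q h
      rw [h6, (afterScan_fields m q (R.st t q) (L.view buf)).2.2.2] at hp
      cases hp

/-- The content of component `j` at time `t`. -/
def cell (t : ℕ) (j : Fin r) : Cell n D := L.view (R.reg t) j

/-- A successful double collect returns the contents of the registers at some time of the scan,
and none of them holds a decision of the current instance. -/
theorem exists_snapshot [NeZero n] {t : ℕ} {q : Fin n} (h : R.lab t = .finish q) :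
    ∃ τ ≤ t, R.Scanning q τ t ∧ (∀ x, (R.reg τ x).hist.length < (R.st t q).inst) ∧
      R.st (t + 1) q = afterScan m q (R.st t q) (R.cell τ) := by
  obtain ⟨h1, h2, h3, buf, k, h4, h5, h6⟩ := R.finish t q h
  obtain ⟨a, ha, g1, g2, g3, g4⟩ := R.scan_inv t q buf k h3 h4
  obtain ⟨τ, e1, e2, e3, e4⟩ := g4 (by omega)
  -- Each register had the collected value once before and once after `τ`, hence also at `τ`.
  have : R.reg τ = buf := by
    funext x
    obtain ⟨t₁, i1, i2⟩ := e3 x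
    obtain ⟨t₂, j1, j2, j3⟩ := e4 x (by omega)
    rw [R.reg_eq_between i1 j1 (i2.trans j3.symm), i2]
  refine ⟨τ, e2, fun s hs1 hs2 => g1 s (e1.trans hs1) hs2, fun x => ?_, ?_⟩
  · rw [this]; exact g2 x (by omega)
  · rw [h6, ← this]; rfl

end Run

/-! ### Components: origin and freshness of their contents; decisions and validity. -/

namespace Run

variable {L : Layout n ρ r D} {m : ℕ} [NeZero ρ] [NeZero r] [Nonempty D] (R : Run L m)

theorem arr_succ (t : ℕ) (q : Fin n) :
    (R.lab t = .write q ∧ (R.st (t + 1) q).arr = newArr q (R.st t q)) ∨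
      (R.lab t ≠ .write q ∧ (R.st (t + 1) q).arr = (R.st t q).arr) := by
  rcases R.lab_cases t q with h | ⟨v, h⟩ | ⟨d, h⟩ | h | h | h
  · refine .inr ⟨fun h' => h (by rw [h']; rfl), ?_⟩
    rw [R.st_frame t q h]
  · refine .inr ⟨by rw [h]; simp, ?_⟩
    rw [(R.invoke t q v h).2.2]; rfl
  · refine .inr ⟨by rw [h]; simp, ?_⟩
    rw [(R.respond t q d h).2.2.1]
  · refine .inl ⟨h, ?_⟩
    rw [(R.write t q h).2.2.2.2.1]; rfl
  · refine .inr ⟨by rw [h]; simp, ?_⟩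
    obtain ⟨-, -, -, buf, k, -, -, h6⟩ := R.read t q h
    rw [h6, (afterRead_fields _ _ _ _ _).1]
  · refine .inr ⟨by rw [h]; simp, ?_⟩
    obtain ⟨-, -, -, buf, k, -, -, h6⟩ := R.finish t q h
    rw [h6, (afterScan_fields _ _ _ _).1]

/-- The cells that `p` keeps are empty or stem from `p`. -/
theorem arr_inv [NeZero n] (t : ℕ) (p : Fin n) (j : Fin r) :
    (R.st t p).arr j = Cell.empty n D ∨ ∃ u, ((R.st t p).arr j).tup = some u ∧ u.id = p ∧
      Fin.ofNat n ((R.st t p).arr j).stamp = p ∧ 0 < ((R.st t p).arr j).stamp ∧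
      ((R.st t p).arr j).stamp ≤ (R.st t p).stamp ∧ u.inst ≤ (R.st t p).inst := by
  induction t with
  | zero => left; rw [R.st_zero]
  | succ t ih =>
    by_cases hsame : (R.st (t + 1) p).arr j = (R.st t p).arr j
    · rw [hsame]
      refine ih.imp id ?_
      rintro ⟨u, h1, h2, h3, h4, h5, h6⟩
      exact ⟨u, h1, h2, h3, h4, h5.trans (R.stamp_mono p t.le_succ),
        h6.trans (R.inst_mono p t.le_succ)⟩
    rcases R.arr_succ t p with ⟨h, ha⟩ | ⟨h, ha⟩
    · by_cases hj : j = (R.st t p).pos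
      · subst hj
        right
        have h5 := (R.write t p h).2.2.2.2.1
        rw [ha, newArr, Function.update_self]
        refine ⟨mine p (R.st t p), rfl, rfl, ofNat_newStamp _ _,
          (Nat.zero_le _).trans_lt (newStamp_gt p _), ?_, ?_⟩
        · rw [h5]; exact le_rfl
        · rw [h5]; exact le_rfl
      · rw [ha, newArr, Function.update_of_ne hj] at hsame
        exact absurd rfl hsame
    · exact absurd (by rw [ha]) hsame

/-- Where the content of a register comes from. -/
theorem reg_origin (t : ℕ) (x : Fin ρ) :
    R.reg t x = RegVal.empty n r D ∨ ∃ w q, w < t ∧ R.lab w = .write q ∧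
      (R.reg t x).arr = (R.st (w + 1) q).arr ∧ (R.reg t x).hist = (R.st w q).hist ∧
      (R.st (w + 1) q).inst = (R.reg t x).hist.length + 1 := by
  rcases R.reg_const_or 0 t (Nat.zero_le _) x with h | ⟨w, q, h1, h2, h3, h4⟩
  · left; rw [h t (Nat.zero_le _) le_rfl, R.reg_zero]
  · right
    obtain ⟨-, -, h6, -, h5, -⟩ := R.write w q h3
    refine ⟨w, q, h2, h3, ?_, ?_, ?_⟩
    · rw [h4, h5]; rfl
    · rw [h4]; rfl
    · rw [h4, h5]; exact (R.undecided_length h6).2.symm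

theorem exists_cell_eq (t : ℕ) (j : Fin r) : ∃ x, R.cell t j = (R.reg t x).arr j := ⟨_, rfl⟩

theorem cell_origin (t : ℕ) (j : Fin r) :
    R.cell t j = Cell.empty n D ∨ ∃ w q, w < t ∧ R.cell t j = (R.st (w + 1) q).arr j := by
  obtain ⟨x, hx⟩ := R.exists_cell_eq t j
  rcases R.reg_origin t x with h | ⟨w, q, h1, -, h2, -⟩
  · left; rw [hx, h]; rfl
  · right; exact ⟨w, q, h1, by rw [hx, h2]⟩

/-- A register that holds a cell of instance `i` holds decisions of all earlier instances. -/
theorem inst_le_length [NeZero n] {t : ℕ} {x : Fin ρ} {j : Fin r} {u : Tuple n D}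
    (h : ((R.reg t x).arr j).tup = some u) : u.inst ≤ (R.reg t x).hist.length + 1 := by
  rcases R.reg_origin t x with h1 | ⟨w, q, -, -, h2, -, h3⟩
  · rw [h1] at h; cases h
  · rw [h2] at h
    rcases R.arr_inv (w + 1) q j with h4 | ⟨u', h4, -, -, -, -, h5⟩
    · rw [h4] at h; cases h
    · rw [h4] at h; cases h; omega

/-- A cell of an instance beyond `N` would come from a register that already holds a decision of
instance `N`. For a scan completed in instance `N`, the hypothesis holds at its snapshot. -/
theorem cell_inst_le [NeZero n] {t N : ℕ} (hN : ∀ x, (R.reg t x).hist.length < N) {j : Fin r}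
    {u : Tuple n D} (h : (R.cell t j).tup = some u) : u.inst ≤ N := by
  obtain ⟨x, hx⟩ := R.exists_cell_eq t j
  rw [hx] at h
  have := R.inst_le_length h
  have := hN x
  omega

section Own

/-- With single-writer registers, the local array of a process always mirrors its register. -/
theorem own_reg {e : Fin n → Fin ρ} (he : Function.Injective e)
    (ht : ∀ p j, L.target p j = e p) (t : ℕ) (p : Fin n) :
    (R.reg t (e p)).arr = (R.st t p).arr := by
  induction t with
  | zero => rw [R.reg_zero, R.st_zero]; rfl
  | succ t ih =>
    rcases R.arr_succ t p with ⟨h, ha⟩ | ⟨h, ha⟩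
    · obtain ⟨-, -, -, -, -, h6⟩ := R.write t p h
      rw [h6, ht, Function.update_self, ha]; rfl
    · rw [ha, ← ih]
      by_cases hq : ∃ q, R.lab t = .write q
      · obtain ⟨q, hq⟩ := hq
        obtain ⟨-, -, -, -, -, h6⟩ := R.write t q hq
        rw [h6, ht, Function.update_of_ne]
        intro h'
        exact h (he h' ▸ hq)
      · rw [R.reg_frame t (not_exists.1 hq)]

end Own

/-- The effect of a write on the components. The write of `q` is lost only if the component holds
a cell of another process with a larger stamp. -/
theorem cell_write [NeZero n] (hL : L.IsDirect ∨ L.IsOwn) {t : ℕ} {q : Fin n}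
    (h : R.lab t = .write q) :
    (∀ j, j ≠ (R.st t q).pos → R.cell (t + 1) j = R.cell t j) ∧
      (R.cell (t + 1) (R.st t q).pos = newCell q (R.st t q) ∨
        R.cell (t + 1) (R.st t q).pos = R.cell t (R.st t q).pos ∧
          (∀ u, (R.cell t (R.st t q).pos).tup = some u → u.id ≠ q) ∧
          newStamp q (R.st t q) < (R.cell t (R.st t q).pos).stamp) := by
  obtain ⟨-, -, -, -, h5, h6⟩ := R.write t q h
  set s := R.st t q with hs
  rcases hL with ⟨e, he, ht, hp⟩ | ⟨e, he, ht, hp⟩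
  · have hc : ∀ t j, R.cell t j = (R.reg t (e j)).arr j := fun t j => by
      simp only [cell, Layout.view, hp]
    refine ⟨fun j hj => ?_, .inl ?_⟩
    · rw [hc, hc, h6, ht, Function.update_of_ne (fun h => hj (he h))]
    · rw [hc, h6, ht, Function.update_self]
      simp [newVal, newArr]
  · have hc : ∀ t j, R.cell t j = (fun x => (R.reg t x).arr j)
        (L.pick j fun x => (R.reg t x).arr j) := fun t j => rfl
    have hown := R.own_reg he.1 ht
    have hreg : ∀ j, (fun x => (R.reg (t + 1) x).arr j) =
        Function.update (fun x => (R.reg t x).arr j) (e q) (newArr q s j) := by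
      intro j
      funext x
      by_cases hx : x = e q
      · subst hx
        rw [h6, ht, Function.update_self, Function.update_self]; rfl
      · rw [h6, ht, Function.update_of_ne hx, Function.update_of_ne hx]
    refine ⟨fun j hj => ?_, ?_⟩
    -- The write replaces the whole register, but away from the current position it repeats the
    -- cells that were there.
    · have : (fun x => (R.reg (t + 1) x).arr j) = fun x => (R.reg t x).arr j := by
        rw [hreg, newArr, Function.update_of_ne hj]
        apply Function.update_eq_self_iff.2
        rw [hown]
      rw [hc, hc, this]
    · have h1 := hreg s.pos
      simp only [newArr, Function.update_self] at h1
      rw [hc, hc, h1]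
      set f : Fin ρ → Cell n D := fun x => (R.reg t x).arr s.pos with hf
      set y := L.pick s.pos (Function.update f (e q) (newCell q s)) with hy
      set z := L.pick s.pos f with hz
      by_cases hyq : y = e q
      · left; rw [hyq, Function.update_self]
      right
      have hmax := hp s.pos (Function.update f (e q) (newCell q s))
      have hmaxf := hp s.pos f
      rw [← hy] at hmax
      rw [← hz] at hmaxf
      rw [Function.update_of_ne hyq] at hmax ⊢
      have hνy : newStamp q s ≤ (f y).stamp := by
        simpa [newCell] using hmax (e q)
      have hνpos : 0 < newStamp q s := (Nat.zero_le _).trans_lt (newStamp_gt q s)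
      -- The new cell of `q` outranks its old one. So if `q` does not win after the write, it did
      -- not win before, and the largest stamp is unchanged.
      have hfe : (f (e q)).stamp < newStamp q s := by
        have : f (e q) = s.arr s.pos := by rw [hf]; simp only; rw [hown]
        rw [this]
        rcases R.arr_inv t q s.pos with h0 | ⟨u, -, -, -, -, h0, -⟩
        · rw [← hs] at h0
          rw [h0]; exact hνpos
        · exact h0.trans_lt (newStamp_gt q s)
      have hzq : z ≠ e q := by
        intro hzq
        have := hmaxf y
        rw [hzq] at this
        omega
      have hyz : (f y).stamp = (f z).stamp := by
        refine le_antisymm (hmaxf y) ?_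
        have := hmax z
        rwa [Function.update_of_ne hzq] at this
      have hcell : ∀ x, 0 < (f x).stamp → ∃ u, (f x).tup = some u ∧ e u.id = x ∧
          Fin.ofNat n (f x).stamp = u.id := by
        intro x hx
        obtain ⟨p, rfl⟩ := he.2 x
        have hfx : f (e p) = (R.st t p).arr s.pos := by rw [hf]; simp only; rw [hown]
        rw [hfx] at hx ⊢
        rcases R.arr_inv t p s.pos with h0 | ⟨u, g1, g2, g3, -⟩
        · rw [h0] at hx; simp [Cell.empty] at hx
        · exact ⟨u, g1, by rw [g2], by rw [g2, g3]⟩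
      obtain ⟨u, hu1, hu2, hu3⟩ := hcell y (by omega)
      obtain ⟨u', hu1', hu2', hu3'⟩ := hcell z (by omega)
      -- Equal stamps have equal residues modulo `n`, hence the same writer and the same register.
      have : y = z := by rw [← hu2, ← hu2', ← hu3, ← hu3', hyz]
      refine ⟨by rw [this], fun v hv hvq => ?_, ?_⟩
      · rw [hu1'] at hv
        cases hv
        exact hzq (by rw [← hu2', hvq])
      · rw [← hyz]
        refine lt_of_le_of_ne hνy fun heq => hyq ?_
        rw [← hu2, ← hu3, ← heq, ofNat_newStamp]

theorem cell_frame {t : ℕ} (h : ∀ q, R.lab t ≠ .write q) (j : Fin r) :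
    R.cell (t + 1) j = R.cell t j := by
  unfold cell; rw [R.reg_frame t h]

/-- The content of component `j` at time `t` was written by `q` at time `w`, and not before `T`. -/
def Fresh (T t : ℕ) (j : Fin r) (q : Fin n) (w : ℕ) : Prop :=
  T ≤ w ∧ w < t ∧ R.lab w = .write q ∧ (R.st w q).pos = j ∧
    ∀ s, w < s → s ≤ t → R.cell s j = newCell q (R.st w q)

variable {R} in
theorem Fresh.cell_eq {T t : ℕ} {j : Fin r} {q : Fin n} {w : ℕ} (h : R.Fresh T t j q w) :
    R.cell t j = newCell q (R.st w q) := h.2.2.2.2 t h.2.1 le_rfl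

variable {R} in
theorem Fresh.tup_eq {T t : ℕ} {j : Fin r} {q : Fin n} {w : ℕ} (h : R.Fresh T t j q w) :
    (R.cell t j).tup = some (mine q (R.st w q)) := by rw [h.cell_eq]; rfl

/-- A step leaves component `j` unchanged or is a successful write to it. -/
theorem cell_succ [NeZero n] (hL : L.IsDirect ∨ L.IsOwn) (t : ℕ) (j : Fin r) :
    R.cell (t + 1) j = R.cell t j ∨ ∃ q, R.lab t = .write q ∧ (R.st t q).pos = j ∧
      R.cell (t + 1) j = newCell q (R.st t q) := by
  by_cases hq : ∃ q, R.lab t = .write q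
  · obtain ⟨q, hq⟩ := hq
    obtain ⟨h1, h2⟩ := R.cell_write hL hq
    by_cases hj : j = (R.st t q).pos
    · subst hj
      rcases h2 with h2 | h2
      · exact .inr ⟨q, hq, rfl, h2⟩
      · exact .inl h2.1
    · exact .inl (h1 j hj)
  · exact .inl (R.cell_frame (not_exists.1 hq) j)

/-- A component is constant over a period, or it was written in that period. -/
theorem cell_const_or_fresh [NeZero n] (hL : L.IsDirect ∨ L.IsOwn) (T t : ℕ) (hT : T ≤ t)
    (j : Fin r) :
    (∀ s, T ≤ s → s ≤ t → R.cell s j = R.cell T j) ∨ ∃ q w, R.Fresh T t j q w := by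
  induction t, hT using Nat.le_induction with
  | base => exact .inl fun s h1 h2 => by rw [le_antisymm h2 h1]
  | succ t hT ih =>
    rcases R.cell_succ hL t j with hsame | ⟨q, hq, hx, h⟩
    · rcases ih with ih | ⟨q, w, h1, h2, h3, h4, h5⟩
      · left
        intro s h1 h2
        rcases Nat.lt_or_ge t s with h | h
        · rw [le_antisymm h2 h, hsame, ih t hT le_rfl]
        · exact ih s h1 h
      · refine .inr ⟨q, w, h1, by omega, h3, h4, fun s hs1 hs2 => ?_⟩
        rcases Nat.lt_or_ge t s with h | h
        · rw [le_antisymm hs2 h, hsame, h5 t h2 le_rfl]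
        · exact h5 s hs1 h
    · refine .inr ⟨q, t, hT, t.lt_succ_self, hq, hx, fun s hs1 hs2 => ?_⟩
      rw [le_antisymm hs2 hs1, h]

variable {R} in
/-- Going back in time, past no write of `q`. -/
theorem Fresh.of_not_write {T t a : ℕ} {j : Fin r} {q : Fin n} {w : ℕ} (h : R.Fresh T t j q w)
    (hn : ∀ s, a ≤ s → s < t → R.lab s ≠ .write q) (ha : a ≤ t) : R.Fresh T a j q w := by
  obtain ⟨h1, h2, h3, h4, h5⟩ := h
  have : w < a := by
    by_contra hw
    exact hn w (by omega) h2 h3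
  exact ⟨h1, this, h3, h4, fun s hs1 hs2 => h5 s hs1 (hs2.trans ha)⟩

/-- The arguments of the `i`th invocations. -/
def inp (i : ℕ) : Set D := {v | ∃ t p, R.lab t = .invoke p v ∧ (R.st t p).inst + 1 = i}

/-- At time `t` process `q` decides `d` in instance `i`, due to a snapshot. -/
def Decides (i t : ℕ) (q : Fin n) (d : D) : Prop :=
  R.lab t = .finish q ∧ (R.st t q).inst = i ∧ (R.st (t + 1) q).hist = (R.st t q).hist ++ [d]

/-- The values decided in instance `i`. -/
def dec (i : ℕ) : Set D := {d | ∃ t q, R.Decides i t q d}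

/-- An adopted list of decisions is traced through the register to its writer at an earlier time,
hence the strong induction. Index `e` of the list belongs to instance `e + 1`. -/
theorem hist_subset_dec (t : ℕ) (q : Fin n) (e : ℕ) (d : D)
    (h : (R.st t q).hist[e]? = some d) : d ∈ R.dec (e + 1) := by
  induction t using Nat.strong_induction_on generalizing q e d with
  | _ t ih =>
    cases t with
    | zero => simp [R.st_zero] at h
    | succ t =>
      have hold := ih t t.lt_succ_self
      rcases R.lab_cases t q with hl | ⟨v, hl⟩ | ⟨d, hl⟩ | hl | hl | hl
      · rw [R.st_frame t q hl] at h; exact hold q e d h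
      · rw [(R.invoke t q v hl).2.2] at h; exact hold q e d h
      · rw [(R.respond t q d hl).2.2.1] at h; exact hold q e _ h
      · rw [(R.write t q hl).2.2.2.2.1] at h; exact hold q e d h
      · obtain ⟨-, -, -, buf, k, -, -, h6⟩ := R.read t q hl
        rw [h6] at h
        rcases (afterRead_fields (R.st t q) buf k (regIndex k)
          (R.reg t (regIndex k))).2.2.2.2.2 with h7 | ⟨-, h7⟩
        · rw [h7] at h; exact hold q e d h
        · rw [h7] at h
          rcases R.reg_origin t (regIndex k) with h8 | ⟨w, p, h8, -, -, h9, -⟩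
          · rw [h8] at h; simp [RegVal.empty] at h
          · rw [h9] at h
            exact ih w (by omega) p e d h
      · obtain ⟨-, -, hu, buf, k, -, -, h6⟩ := R.finish t q hl
        rcases afterScan_eq_or m q (R.st t q) (L.view buf) with f | f | f
        · rw [h6, f.2.2.2, List.getElem?_append] at h
          split_ifs at h with he
          · exact hold q e d h
          · have hlen := (R.undecided_length hu).2
            rw [List.getElem?_singleton] at h
            split_ifs at h with he'
            simp only [Option.some.injEq] at h
            exact ⟨t, q, hl, by omega, by rw [h6, f.2.2.2, h]⟩
        · rw [h6, f.2.2.2.2] at h; exact hold q e d h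
        · rw [h6, f.2.2.2.2] at h; exact hold q e d h

/-- Preferred values and announced values were proposed in the same instance. -/
theorem valid_inv [NeZero n] (t : ℕ) :
    (∀ q, 1 ≤ (R.st t q).inst → (R.st t q).pref ∈ R.inp (R.st t q).inst) ∧
      ∀ q j u, ((R.st t q).arr j).tup = some u → u.val ∈ R.inp u.inst := by
  induction t using Nat.strong_induction_on with
  | _ t ih =>
    cases t with
    | zero => simp [R.st_zero, Cell.empty]
    | succ t =>
      obtain ⟨hold1, hold2⟩ := ih t t.lt_succ_self
      refine ⟨fun q hq => ?_, fun q j u hu => ?_⟩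
      · rcases R.lab_cases t q with hl | ⟨v, hl⟩ | ⟨d, hl⟩ | hl | hl | hl
        · rw [R.st_frame t q hl] at hq ⊢; exact hold1 q hq
        · rw [(R.invoke t q v hl).2.2]; exact ⟨t, q, hl, rfl⟩
        · rw [(R.respond t q d hl).2.2.1] at hq ⊢; exact hold1 q hq
        · rw [(R.write t q hl).2.2.2.2.1] at hq ⊢; exact hold1 q hq
        · obtain ⟨-, -, -, buf, k, -, -, h6⟩ := R.read t q hl
          obtain ⟨-, -, f1, -, f2, -⟩ := afterRead_fields (R.st t q) buf k (regIndex k)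
            (R.reg t (regIndex k))
          rw [h6, f1] at hq
          rw [h6, f1, f2]; exact hold1 q hq
        · obtain ⟨τ, hτ, -, -, h6⟩ := R.exists_snapshot hl
          have f1 := (afterScan_fields m q (R.st t q) (R.cell τ)).2.2.1
          rw [h6, f1] at hq
          rw [h6, f1]
          rcases afterScan_eq_or m q (R.st t q) (R.cell τ) with f | f | f
          · rw [f.2.2.1]; exact hold1 q hq
          · obtain ⟨j, -, u, -, hj, -, hu1, hu2⟩ := f.2.2.2.1
            rw [← hu2, ← hu1]
            rcases R.cell_origin τ j with h8 | ⟨w, p, h8, h9⟩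
            · rw [h8] at hj; cases hj
            · rw [h9] at hj
              exact (ih (w + 1) (by omega)).2 p j u hj
          · rw [f.2.2.2.1]; exact hold1 q hq
      · rcases R.arr_succ t q with ⟨h, ha⟩ | ⟨h, ha⟩
        · rw [ha, newArr] at hu
          by_cases hj : j = (R.st t q).pos
          · subst hj
            rw [Function.update_self] at hu
            cases hu
            have h1 := (R.write t q h).2.2.1
            exact hold1 q ((Nat.zero_le _).trans_lt h1)
          · rw [Function.update_of_ne hj] at hu
            exact hold2 q j u hu
        · rw [ha] at hu; exact hold2 q j u hu

theorem cell_valid [NeZero n] {t : ℕ} {j : Fin r} {u : Tuple n D}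
    (h : (R.cell t j).tup = some u) : u.val ∈ R.inp u.inst := by
  rcases R.cell_origin t j with h8 | ⟨w, p, h8, h9⟩
  · rw [h8] at h; cases h
  · rw [h9] at h
    exact (R.valid_inv (w + 1)).2 p j u h

/-- The snapshot behind a decision. -/
theorem Decides.snapshot [NeZero n] {R : Run L m} (hm : m < r) {i t : ℕ} {q : Fin n} {d : D}
    (h : R.Decides i t q d) :
    ∃ τ ≤ t, R.Scanning q τ t ∧ (∀ x, (R.reg τ x).hist.length < i) ∧ Full m i (R.cell τ) ∧
      d ∈ dupSet (R.cell τ) i := by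
  obtain ⟨h1, rfl, h3⟩ := h
  obtain ⟨τ, hτ, g1, g2, g3⟩ := R.exists_snapshot h1
  refine ⟨τ, hτ, g1, g2, ?_⟩
  rcases afterScan_eq_or m q (R.st t q) (R.cell τ) with f | f | f
  · refine ⟨f.1, ?_⟩
    rw [g3, f.2.2.2, List.append_right_inj, List.cons.injEq] at h3
    rw [← h3.1]
    exact Classical.epsilon_spec (f.1.dupSet_nonempty hm)
  · rw [g3, f.2.2.2.2] at h3; simp at h3
  · rw [g3, f.2.2.2.2] at h3; simp at h3

theorem dec_subset_inp [NeZero n] (hm : m < r) (i : ℕ) : R.dec i ⊆ R.inp i := by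
  rintro d ⟨t, q, h⟩
  obtain ⟨τ, -, -, -, -, j, -, u, -, hj, -, rfl, rfl⟩ := h.snapshot hm
  exact R.cell_valid hj

end Run

/-! ### The invariant `Steady` on the components that one process has written. -/

namespace Run

variable {L : Layout n ρ r D} {m : ℕ} [NeZero ρ] [NeZero r] [Nonempty D] {R : Run L m}

/-- All components that `q` has written since `T` hold its current tuple, which is not bad, or they
are at its current position. While `q` scans, they hold its current tuple in any case. -/
def Steady (R : Run L m) (bad : Tuple n D → Prop) (T t : ℕ) (q : Fin n) : Prop :=
  ((∀ j w, R.Fresh T t j q w → (R.cell t j).tup = some (mine q (R.st t q))) ∧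
      ¬ bad (mine q (R.st t q)) ∨
    ∀ j w, R.Fresh T t j q w → j = (R.st t q).pos) ∧
  ((∃ b k, (R.st t q).phase = .scan b k) →
    ∀ j w, R.Fresh T t j q w → (R.cell t j).tup = some (mine q (R.st t q)))

theorem Fresh.pred {T t : ℕ} {j : Fin r} {q : Fin n} {w : ℕ} (h : R.Fresh T (t + 1) j q w)
    (hw : w ≠ t) : R.Fresh T t j q w ∧ R.cell (t + 1) j = R.cell t j := by
  obtain ⟨h1, h2, h3, h4, h5⟩ := h
  have hwt : w < t := by omega
  exact ⟨⟨h1, hwt, h3, h4, fun s hs1 hs2 => h5 s hs1 (by omega)⟩,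
    by rw [h5 (t + 1) h2 le_rfl, h5 t hwt t.le_succ]⟩

theorem Fresh.pred_of_ne {T t : ℕ} {j : Fin r} {q : Fin n} {w : ℕ} (h : R.Fresh T (t + 1) j q w)
    (hl : R.lab t ≠ .write q) : R.Fresh T t j q w ∧ R.cell (t + 1) j = R.cell t j :=
  h.pred fun hw => hl (hw ▸ h.2.2.1)

theorem steady_self (bad : Tuple n D → Prop) (T : ℕ) (q : Fin n) : R.Steady bad T T q := by
  have : ∀ j w, ¬ R.Fresh T T j q w := fun j w h => by have := h.1; have := h.2.1; omega
  exact ⟨.inr fun j w h => absurd h (this j w), fun _ j w h => absurd h (this j w)⟩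

/-- `Steady` is preserved by steps that do not affect tuple and position of `q`. -/
theorem Steady.of_same {bad : Tuple n D → Prop} {T t : ℕ} {q : Fin n} (h : R.Steady bad T t q)
    (hl : R.lab t ≠ .write q) (hm : mine q (R.st (t + 1) q) = mine q (R.st t q))
    (hp : (R.st (t + 1) q).pos = (R.st t q).pos)
    (hs : (∃ b k, (R.st (t + 1) q).phase = .scan b k) → ∃ b k, (R.st t q).phase = .scan b k) :
    R.Steady bad T (t + 1) q := by
  unfold Steady
  rw [hm, hp]
  refine ⟨h.1.imp (fun h1 => ⟨fun j w hf => ?_, h1.2⟩) fun h1 j w hf => ?_, fun h1 j w hf => ?_⟩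
  · obtain ⟨hf, hc⟩ := hf.pred_of_ne hl
    rw [hc]; exact h1.1 j w hf
  · exact h1 j w (hf.pred_of_ne hl).1
  · obtain ⟨hf, hc⟩ := hf.pred_of_ne hl
    rw [hc]; exact h.2 (hs h1) j w hf

/-- The only component that could hold an outdated tuple of `q` is the one being overwritten. If the
write is lost, that component holds a cell of another process and is not fresh for `q`. -/
theorem Steady.write [NeZero n] (hL : L.IsDirect ∨ L.IsOwn) {bad : Tuple n D → Prop} {T t : ℕ}
    {q : Fin n} (h : R.Steady bad T t q) (hl : R.lab t = .write q) :
    R.Steady bad T (t + 1) q := by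
  have h2 := (R.cell_write hL hl).2
  obtain ⟨-, -, -, -, h5, -⟩ := R.write t q hl
  have hm : mine q (R.st (t + 1) q) = mine q (R.st t q) := by rw [h5]; rfl
  have hp : (R.st (t + 1) q).pos = (R.st t q).pos := by rw [h5]; rfl
  have hpos : ∀ w, R.Fresh T (t + 1) (R.st t q).pos q w →
      (R.cell (t + 1) (R.st t q).pos).tup = some (mine q (R.st t q)) := by
    intro w hf
    rcases h2 with h2 | ⟨h2, h3, -⟩
    · rw [h2]; rfl
    · have := hf.tup_eq
      rw [h2] at this
      exact absurd rfl (h3 _ this)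
  have hold : ∀ j w, R.Fresh T (t + 1) j q w → j ≠ (R.st t q).pos →
      R.Fresh T t j q w ∧ R.cell (t + 1) j = R.cell t j := fun j w hf hj =>
    hf.pred fun hw => hj (by rw [← hf.2.2.2.1, hw])
  have hall : ∀ j w, R.Fresh T (t + 1) j q w →
      (R.cell (t + 1) j).tup = some (mine q (R.st t q)) := by
    intro j w hf
    by_cases hj : j = (R.st t q).pos
    · subst hj; exact hpos w hf
    · obtain ⟨hf, hc⟩ := hold j w hf hj
      rw [hc]
      rcases h.1 with h | h
      · exact h.1 j w hf
      · exact absurd (h j w hf) hj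
  unfold Steady
  rw [hm, hp]
  refine ⟨h.1.imp (fun h1 => ⟨hall, h1.2⟩) fun h1 j w hf => ?_, fun _ => hall⟩
  by_contra hj
  exact hj (h1 j w (hold j w hf hj).1)

/-- `Steady` is preserved by all steps except invocations, provided that a process with a bad
tuple does not advance its position. -/
theorem Steady.succ [NeZero n] (hL : L.IsDirect ∨ L.IsOwn) {bad : Tuple n D → Prop} {T t : ℕ}
    {q : Fin n} (h : R.Steady bad T t q) (hinv : ∀ v, R.lab t ≠ .invoke q v)
    (hfin : ∀ τ ≤ t, R.lab t = .finish q → R.Scanning q τ t →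
      (∀ x, (R.reg τ x).hist.length < (R.st t q).inst) → ¬ Adopts q (R.st t q) (R.cell τ) →
      bad (mine q (R.st t q)) → ∀ j w, ¬ R.Fresh T t j q w) :
    R.Steady bad T (t + 1) q := by
  rcases R.lab_cases t q with hl | ⟨v, hl⟩ | ⟨d, hl⟩ | hl | hl | hl
  · have hs := R.st_frame t q hl
    exact h.of_same (fun h' => hl (by rw [h']; rfl)) (by rw [hs]) (by rw [hs]) (by rw [hs]; exact id)
  · exact absurd hl (hinv v)
  · have hs := (R.respond t q d hl).2.2.1
    exact h.of_same (by rw [hl]; simp) (by rw [hs]) (by rw [hs]) (by rw [hs]; exact id)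
  · exact h.write hL hl
  · obtain ⟨-, -, -, buf, k, h4, -, h6⟩ := R.read t q hl
    obtain ⟨-, -, f1, f2, f3, -⟩ := afterRead_fields (R.st t q) buf k (regIndex k)
      (R.reg t (regIndex k))
    rw [← h6] at f1 f2 f3
    exact h.of_same (by rw [hl]; simp) (by simp only [mine, f1, f3]) f2 fun _ => ⟨buf, k, h4⟩
  · have hnw : R.lab t ≠ .write q := by rw [hl]; simp
    obtain ⟨τ, hτ, g1, g2, g3⟩ := R.exists_snapshot hl
    obtain ⟨-, -, f1, f0⟩ := afterScan_fields m q (R.st t q) (R.cell τ)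
    have hall := h.2 (g1 t hτ le_rfl).1
    have hns : ¬ ∃ b k, (R.st (t + 1) q).phase = .scan b k := by
      rintro ⟨b, k, hbk⟩
      rw [g3, f0] at hbk
      cases hbk
    rcases afterScan_eq_or m q (R.st t q) (R.cell τ) with f | f | f
    · rw [← g3] at f f1
      exact h.of_same hnw (by simp only [mine, f1, f.2.2.1]) f.2.1 fun h' => absurd h' hns
    -- Adoption: the fresh components of `q` held its tuple already at the snapshot, and `Adopts`
    -- excludes this away from the current position.
    · refine ⟨.inr fun j w hf => ?_, fun h' => absurd h' hns⟩
      have hf := (hf.pred_of_ne hnw).1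
      have hfτ := hf.of_not_write (fun s hs1 hs2 => g1.not_write hs1 hs2.le) hτ
      rw [g3, f.2.2.1]
      by_contra hj
      apply f.2.1.1 j hj
      rw [hfτ.cell_eq, ← hf.cell_eq]
      exact hall j w hf
    · refine ⟨?_, fun h' => absurd h' hns⟩
      have hmine : mine q (R.st (t + 1) q) = mine q (R.st t q) := by
        rw [g3]; simp only [mine, f1, f.2.2.2.1]
      -- Advance: with a good tuple the first alternative of `Steady` holds; with a bad one, `hfin`
      -- leaves no fresh component.
      by_cases hb : bad (mine q (R.st t q))
      · right
        intro j w hf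
        exact absurd (hf.pred_of_ne hnw).1 (hfin τ hτ hl g1 g2 f.2.1 hb j w)
      · left
        rw [hmine]
        refine ⟨fun j w hf => ?_, hb⟩
        obtain ⟨hf, hc⟩ := hf.pred_of_ne hnw
        rw [hc]
        exact hall j w hf

/-! ### Agreement. -/

section Agreement

/-- The values present at time `T`. -/
def present (R : Run L m) (T : ℕ) : Set D := {d | ∃ j u, (R.cell T j).tup = some u ∧ u.val = d}

theorem present_encard_le {T i : ℕ} (h : Full m i (R.cell T)) : (R.present T).encard ≤ m := by
  have hsub : R.present T ⊆ (fun o : Option (Tuple n D) =>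
      o.elim (Classical.arbitrary D) Tuple.val) '' Set.range fun j => (R.cell T j).tup := by
    rintro d ⟨j, u, hj, rfl⟩
    exact ⟨_, ⟨j, rfl⟩, by simp [hj]⟩
  refine (Set.encard_le_encard hsub).trans ((Set.encard_image_le _ _).trans ?_)
  rw [← Set.Finite.cast_ncard_eq (Set.finite_range _)]
  exact_mod_cast h.2

/-- Tuples that do not support a value present at time `T` in instance `i`. -/
def IsBad (R : Run L m) (T i : ℕ) (u : Tuple n D) : Prop := u.inst ≠ i ∨ u.val ∉ R.present T

/-- The components that `q` has written since `T` in instances up to `i` hold the same tuple,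
which is not bad, or there is only one of them. -/
def Uniform (R : Run L m) (T i t : ℕ) (q : Fin n) : Prop :=
  (∃ u, ¬ R.IsBad T i u ∧ ∀ j w, R.Fresh T t j q w → (R.st w q).inst ≤ i →
      (R.cell t j).tup = some u) ∨
    ∃ p, ∀ j w, R.Fresh T t j q w → (R.st w q).inst ≤ i → j = p

theorem Steady.uniform {T i t : ℕ} {q : Fin n} (h : R.Steady (R.IsBad T i) T t q) :
    R.Uniform T i t q :=
  h.1.imp (fun h => ⟨_, h.2, fun j w hf _ => h.1 j w hf⟩) fun h => ⟨_, fun j w hf _ => h j w hf⟩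

/-- After `T`, processes in `F` no longer write in instances up to `i`, and there are enough
components to prevent the others from erasing what is present at `T`. -/
structure Window (R : Run L m) (T i : ℕ) (F : Finset (Fin n)) : Prop where
  full : Full m i (R.cell T)
  gone : ∀ q ∈ F, ∀ t, T ≤ t → R.lab t = .write q → i < (R.st t q).inst
  card : m + (n - F.card) < r

variable {T i : ℕ} {F : Finset (Fin n)}

/-- A component rewritten since `T` by a process in `F` would belong to an instance beyond `i`,
which `hlow` excludes. -/
theorem Window.cell_cases [NeZero n] (hL : L.IsDirect ∨ L.IsOwn) (hW : R.Window T i F) {t : ℕ}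
    (ht : T ≤ t) (hlow : ∀ x, (R.reg t x).hist.length < i) (j : Fin r) :
    (∃ u, (R.cell t j).tup = some u ∧ (R.cell T j).tup = some u ∧ u.inst = i ∧
      u.val ∈ R.present T) ∨ ∃ q w, q ∉ F ∧ R.Fresh T t j q w ∧ (R.st w q).inst ≤ i := by
  rcases R.cell_const_or_fresh hL T t ht j with h | ⟨q, w, h⟩
  · left
    obtain ⟨u, h1, h2⟩ := hW.full.1 j
    exact ⟨u, by rw [h t ht le_rfl, h1], h1, h2, j, u, h1, rfl⟩
  · right
    have hi : (R.st w q).inst ≤ i := R.cell_inst_le hlow h.tup_eq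
    refine ⟨q, w, fun hq => ?_, h, hi⟩
    have := hW.gone q hq w h.1 h.2.2.1
    omega

/-- If one of the two components is unchanged since `T`, the value is present. If both are fresh,
then, as tuples contain identifiers, they have the same writer, to which `Uniform` applies. -/
theorem Window.dupSet_subset [NeZero n] (hL : L.IsDirect ∨ L.IsOwn) (hW : R.Window T i F) {t : ℕ}
    (ht : T ≤ t) (hlow : ∀ x, (R.reg t x).hist.length < i)
    (hU : ∀ q, q ∉ F → R.Uniform T i t q) : dupSet (R.cell t) i ⊆ R.present T := by
  rintro d ⟨j₁, j₂, u, hne, h1, h2, hi, rfl⟩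
  rcases hW.cell_cases hL ht hlow j₁ with ⟨u', g1, -, -, g2⟩ | ⟨q, w, hq, g1, g2⟩
  · rw [h1] at g1; cases g1; exact g2
  rcases hW.cell_cases hL ht hlow j₂ with ⟨u', g1', -, -, g2'⟩ | ⟨q', w', hq', g1', g2'⟩
  · rw [h2] at g1'; cases g1'; exact g2'
  have e1 := g1.tup_eq
  have e2 := g1'.tup_eq
  rw [h1] at e1
  rw [h2] at e2
  cases e1
  simp only [mine, Option.some.injEq, Tuple.mk.injEq] at e2
  obtain ⟨rfl, -⟩ := e2
  rcases hU q hq with ⟨v, hv, h⟩ | ⟨p, h⟩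
  · have := h j₁ w g1 g2
    rw [h1] at this
    cases this
    by_contra hd
    exact hv (.inr hd)
  · exact absurd ((h j₁ w g1 g2).trans (h j₂ w' g1' g2').symm) hne

/-- Pigeonhole: each component is assigned its tuple if that has survived since `T` (at most `m`
choices), and otherwise its writer outside `F` (`n - F.card` choices). Two components with the same
assignment hold the same tuple of instance `i`. -/
theorem Window.dupSet_nonempty [NeZero n] (hL : L.IsDirect ∨ L.IsOwn) (hW : R.Window T i F)
    {t : ℕ} (ht : T ≤ t) (hlow : ∀ x, (R.reg t x).hist.length < i)
    (hU : ∀ q, q ∉ F → R.Uniform T i t q) : (dupSet (R.cell t) i).Nonempty := by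
  classical
  have hf : ∀ j, ∃ y : Option (Tuple n D) ⊕ Fin n,
      (∃ u, y = .inl (some u) ∧ (R.cell t j).tup = some u ∧ (R.cell T j).tup = some u ∧
        u.inst = i) ∨ ∃ q w, y = .inr q ∧ q ∉ F ∧ R.Fresh T t j q w ∧ (R.st w q).inst ≤ i := by
    intro j
    rcases hW.cell_cases hL ht hlow j with ⟨u, h1, h2, h3, -⟩ | ⟨q, w, h⟩
    · exact ⟨_, .inl ⟨u, rfl, h1, h2, h3⟩⟩
    · exact ⟨_, .inr ⟨q, w, rfl, h⟩⟩
  choose f hf using hf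
  let S : Finset (Option (Tuple n D) ⊕ Fin n) :=
    (Finset.univ.image fun j => (R.cell T j).tup).disjSum (Finset.univ \ F)
  have hS : S.card < (Finset.univ : Finset (Fin r)).card := by
    have h1 : (Finset.univ.image fun j => (R.cell T j).tup).card ≤ m := by
      have := hW.full.2
      rwa [← Set.ncard_coe_finset, Finset.coe_image, Finset.coe_univ, Set.image_univ]
    have h2 : (Finset.univ \ F).card = n - F.card := by
      rw [← Finset.compl_eq_univ_sdiff, Finset.card_compl, Fintype.card_fin]
    rw [Finset.card_disjSum, h2, Finset.card_univ, Fintype.card_fin]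
    exact lt_of_le_of_lt (Nat.add_le_add_right h1 _) hW.card
  have hmaps : ∀ j ∈ (Finset.univ : Finset (Fin r)), f j ∈ S := by
    intro j _
    rcases hf j with ⟨u, h1, h2, h3, -⟩ | ⟨q, w, h1, h2, -⟩
    · rw [h1, Finset.inl_mem_disjSum, Finset.mem_image]
      exact ⟨j, Finset.mem_univ _, h3⟩
    · rw [h1, Finset.inr_mem_disjSum]
      simpa using h2
  obtain ⟨j₁, -, j₂, -, hne, heq⟩ := Finset.exists_ne_map_eq_of_card_lt_of_maps_to hS hmaps
  rcases hf j₁ with ⟨u, h1, h2, h3, h4⟩ | ⟨q, w, h1, h2, h3, h4⟩ <;>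
    rcases hf j₂ with ⟨u', h1', h2', h3', h4'⟩ | ⟨q', w', h1', h2', h3', h4'⟩ <;>
    rw [h1, h1'] at heq <;> cases heq
  · exact ⟨_, j₁, j₂, u, hne, h2, h2', h4, rfl⟩
  · rcases hU q h2 with ⟨v, hv, h⟩ | ⟨p, h⟩
    · have hvi : v.inst = i := by
        by_contra hd
        exact hv (.inl hd)
      exact ⟨_, j₁, j₂, v, hne, h j₁ w h3 h4, h j₂ w' h3' h4', hvi, rfl⟩
    · exact absurd ((h j₁ w h3 h4).trans (h j₂ w' h3' h4').symm) hne

/-- The invariant that protects the values present at time `T`. -/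
theorem Window.invariant [NeZero n] (hL : L.IsDirect ∨ L.IsOwn) (hW : R.Window T i F) (t : ℕ)
    (ht : T ≤ t) (q : Fin n) (hq : q ∉ F) :
    ((R.st t q).inst ≤ i → R.Steady (R.IsBad T i) T t q) ∧ R.Uniform T i t q := by
  induction t using Nat.strong_induction_on generalizing q with
  | _ t ih =>
    rcases ht.eq_or_lt with rfl | ht
    · exact ⟨fun _ => steady_self _ _ _, (steady_self _ _ _).uniform⟩
    obtain ⟨t, rfl⟩ : ∃ s, t = s + 1 := ⟨t - 1, by omega⟩
    obtain ⟨ih1, ih2⟩ := ih t t.lt_succ_self (by omega) q hq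
    by_cases hi : (R.st t q).inst ≤ i
    -- Beyond instance `i` the process makes no further writes that count, so only `Uniform` has to
    -- be carried along.
    swap
    · refine ⟨fun h => absurd ((R.inst_mono q t.le_succ).trans h) hi, ?_⟩
      have hpred : ∀ j w, R.Fresh T (t + 1) j q w → (R.st w q).inst ≤ i →
          R.Fresh T t j q w ∧ R.cell (t + 1) j = R.cell t j := fun j w hf hw =>
        hf.pred (by rintro rfl; exact hi hw)
      refine ih2.imp ?_ ?_
      · rintro ⟨u, hu, h⟩
        refine ⟨u, hu, fun j w hf hw => ?_⟩
        obtain ⟨hf, hc⟩ := hpred j w hf hw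
        rw [hc]; exact h j w hf hw
      · rintro ⟨p, h⟩
        exact ⟨p, fun j w hf hw => h j w (hpred j w hf hw).1 hw⟩
    have ih1 := ih1 hi
    by_cases hinv : ∃ v, R.lab t = .invoke q v
    · obtain ⟨v, hv⟩ := hinv
      have h3 := (R.invoke t q v hv).2.2
      have hnw : R.lab t ≠ .write q := by rw [hv]; simp
      constructor
      · intro hi'
        rw [h3] at hi'
        -- The operation that just ended was of an instance before `i`, so its tuple is bad and the
        -- fresh components are confined to the position, which the invocation keeps.
        have hbad : R.IsBad T i (mine q (R.st t q)) := .inl (by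
          simp only [State.onInvoke] at hi'
          simp only [mine]; omega)
        refine ⟨.inr fun j w hf => ?_, ?_⟩
        · rw [h3]
          rcases ih1.1 with h | h
          · exact absurd hbad h.2
          · exact h j w (hf.pred_of_ne hnw).1
        · rw [h3]
          rintro ⟨b, k, hbk⟩
          cases hbk
      · refine ih2.imp ?_ ?_
        · rintro ⟨u, hu, h⟩
          refine ⟨u, hu, fun j w hf hw => ?_⟩
          obtain ⟨hf, hc⟩ := hf.pred_of_ne hnw
          rw [hc]; exact h j w hf hw
        · rintro ⟨p, h⟩
          exact ⟨p, fun j w hf hw => h j w (hf.pred_of_ne hnw).1 hw⟩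
    suffices hst : R.Steady (R.IsBad T i) T (t + 1) q from ⟨fun _ => hst, hst.uniform⟩
    refine ih1.succ hL (not_exists.1 hinv) fun τ hτ hl hsc hlow hna hbad j w hf => ?_
    -- If the snapshot precedes `T`, then `q` has been scanning since before `T` and has no fresh
    -- component at all.
    rcases Nat.lt_or_ge τ T with hτT | hτT
    · exact hsc.not_write (by have := hf.1; omega) hf.2.1.le hf.2.2.1
    have hτs := hsc τ le_rfl hτ
    have hU : ∀ q, q ∉ F → R.Uniform T i τ q := fun p hp => (ih τ (by omega) hτT p hp).2
    have hSτ := (ih τ (by omega) hτT q hq).1 (by rw [hτs.2.2.1]; exact hi)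
    have hlow' : ∀ x, (R.reg τ x).hist.length < i := fun x => (hlow x).trans_le hi
    have hne := hW.dupSet_nonempty hL hτT hlow' hU
    have hsub := hW.dupSet_subset hL hτT hlow' hU
    -- A scan in an earlier instance could not have ended, since it would have met cells of instance
    -- `i`.
    have hinst : (R.st t q).inst = i := by
      obtain ⟨d, j₁, -, u, -, h1, -, h2, -⟩ := hne
      have := R.cell_inst_le hlow h1
      omega
    have hpref : (R.st t q).pref ∉ R.present T := by
      rcases hbad with h | h
      · exact absurd hinst h
      · exact h
    have hmine : mine q (R.st τ q) = mine q (R.st t q) := by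
      simp only [mine, hτs.2.2.1, hτs.2.2.2.2]
    -- All conditions for adoption are met, so the process does not advance with a bad tuple.
    apply hna
    refine ⟨fun j' hj' hc => ?_, by rwa [hinst], by rw [hinst]; exact fun h => hpref (hsub h)⟩
    rcases hW.cell_cases hL hτT hlow' j' with ⟨u, h1, -, -, h2⟩ | ⟨q', w', -, h1, -⟩
    · rw [hc] at h1
      cases h1
      exact hpref h2
    · have h2 := h1.tup_eq
      rw [hc] at h2
      simp only [mine, Option.some.injEq, Tuple.mk.injEq] at h2
      obtain ⟨rfl, -⟩ := h2
      rcases hSτ.1 with h | h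
      · exact h.2 (hmine ▸ hbad)
      · exact hj' ((h j' w' h1).trans hτs.2.2.2.1)

theorem Window.decided_mem [NeZero n] (hL : L.IsDirect ∨ L.IsOwn) (hW : R.Window T i F) {t : ℕ}
    (ht : T ≤ t) (hlow : ∀ x, (R.reg t x).hist.length < i) {d : D}
    (hd : d ∈ dupSet (R.cell t) i) : d ∈ R.present T :=
  hW.dupSet_subset hL ht hlow (fun q hq => (hW.invariant hL t ht q hq).2) hd

theorem Decides.length {t : ℕ} {q : Fin n} {d : D} (h : R.Decides i t q d) {s : ℕ} (hs : t < s) :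
    i ≤ (R.st s q).hist.length := by
  obtain ⟨h1, h2, h3⟩ := h
  have h4 := (R.undecided_length (R.finish t q h1).2.2.1).2
  have h5 := R.length_mono q (show t + 1 ≤ s from hs)
  simp only [h3, List.length_append, List.length_singleton] at h5
  omega

theorem Decides.unique {t t' : ℕ} {q : Fin n} {d d' : D} (h : R.Decides i t q d)
    (h' : R.Decides i t' q d') : t = t' ∧ d = d' := by
  have key : ∀ {t t' : ℕ} {d d' : D}, R.Decides i t q d → R.Decides i t' q d' → ¬ t < t' := by
    intro t t' d d' h h' hlt
    have h1 := h.length hlt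
    have h2 := (R.finish t' q h'.1).2.2.1
    have h3 := h'.2.1
    unfold State.Undecided at h2
    omega
  have : t = t' := le_antisymm (not_lt.1 (key h' h)) (not_lt.1 (key h h'))
  subst this
  have := h.2.2.symm.trans h'.2.2
  simp only [List.append_cancel_left_eq, List.cons.injEq, and_true] at this
  exact ⟨rfl, this⟩

/-- At most `k` values are decided in an instance. -/
theorem dec_encard_le [NeZero n] (hL : L.IsDirect ∨ L.IsOwn) (k : ℕ) (hm : 1 ≤ m) (hmk : m ≤ k)
    (hkn : k < n) (hr : n + 2 * m = r + k) (i : ℕ) : (R.dec i).encard ≤ k := by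
  classical
  have hmr : m < r := by omega
  let S : Finset (Fin n) := Finset.univ.filter fun q => ∃ t d, R.Decides i t q d
  have hS : ∀ q : Fin n, ∃ (t : ℕ) (d : D) (τ : ℕ), q ∈ S → R.Decides i t q d ∧ τ ≤ t ∧
      R.Scanning q τ t ∧ (∀ x, (R.reg τ x).hist.length < i) ∧ Full m i (R.cell τ) ∧
      d ∈ dupSet (R.cell τ) i := by
    intro q
    by_cases hq : q ∈ S
    · obtain ⟨t, d, h⟩ := (Finset.mem_filter.1 hq).2
      obtain ⟨τ, h1, h2⟩ := h.snapshot hmr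
      exact ⟨t, d, τ, fun _ => ⟨h, h1, h2⟩⟩
    · exact ⟨0, Classical.arbitrary D, 0, fun h => absurd h hq⟩
  choose t d τ hS using hS
  have hdec : R.dec i ⊆ d '' S := by
    rintro v ⟨s, q, h⟩
    have hq : q ∈ S := Finset.mem_filter.2 ⟨Finset.mem_univ _, s, v, h⟩
    exact ⟨q, hq, ((hS q hq).1.unique h).2⟩
  -- Each process decides at most once per instance, so only more than `k` deciding processes need
  -- an argument.
  by_cases hcard : S.card ≤ k
  · refine (Set.encard_le_encard hdec).trans ((Set.encard_image_le _ _).trans ?_)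
    rw [Set.encard_coe_eq_coe_finsetCard]
    exact_mod_cast hcard
  have hex : ∃ T, k - m + 1 ≤ (S.filter fun q => τ q ≤ T).card := by
    refine ⟨S.sup τ, ?_⟩
    rw [Finset.filter_true_of_mem fun q hq => Finset.le_sup hq]
    omega
  let T := Nat.find hex
  have hT : k - m + 1 ≤ (S.filter fun q => τ q ≤ T).card := Nat.find_spec hex
  have hlt : (S.filter fun q => τ q < T).card ≤ k - m := by
    rcases Nat.eq_zero_or_pos T with h0 | h0
    · rw [h0]; simp
    · have := Nat.find_min hex (Nat.sub_lt h0 one_pos)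
      have heq : (S.filter fun q => τ q < T) = S.filter fun q => τ q ≤ T - 1 :=
        Finset.filter_congr fun q _ => by omega
      rw [heq]
      have : ¬ k - m + 1 ≤ (S.filter fun q => τ q ≤ T - 1).card := this
      omega
  obtain ⟨q₀, hq₀, hτ₀⟩ : ∃ q ∈ S, τ q = T := by
    by_contra hno
    have heq : (S.filter fun q => τ q ≤ T) = S.filter fun q => τ q < T := by
      refine Finset.filter_congr fun q hq => ⟨fun h => lt_of_le_of_ne h fun h' => hno ⟨q, hq, h'⟩,
        le_of_lt⟩
    rw [heq] at hT
    omega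
  -- The snapshot of `q₀` at `T` supplies `full`. Each `q` counted here scans from its snapshot to
  -- its decision, and thereafter writes only in instances beyond `i`. The count is `m + (n - (k - m
  -- + 1)) = r - 1`.
  have hW : R.Window T i (S.filter fun q => τ q ≤ T) := by
    refine ⟨hτ₀ ▸ (hS q₀ hq₀).2.2.2.2.1, fun q hq s hs hw => ?_, ?_⟩
    · obtain ⟨hq, hqT⟩ := Finset.mem_filter.1 hq
      obtain ⟨h1, h2, h3, -⟩ := hS q hq
      rcases Nat.lt_or_ge (t q) s with hts | hts
      · exact (h1.length hts).trans_lt (R.write s q hw).2.2.1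
      · exact absurd hw (h3.not_write (hqT.trans hs) hts)
    · have hcn : (S.filter fun q => τ q ≤ T).card ≤ n := card_finset_fin_le _
      omega
  -- At most `k - m` values come from snapshots before `T`, at most `m` from later ones.
  have hsub : R.dec i ⊆ d '' (S.filter fun q => τ q < T) ∪ R.present T := by
    intro v hv
    obtain ⟨q, hq, rfl⟩ := hdec hv
    rcases Nat.lt_or_ge (τ q) T with h | h
    · exact .inl ⟨q, by simpa using ⟨hq, h⟩, rfl⟩
    · obtain ⟨-, -, -, h3, -, h4⟩ := hS q hq
      exact .inr (hW.decided_mem hL h h3 h4)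
  refine (Set.encard_le_encard hsub).trans ((Set.encard_union_le _ _).trans ?_)
  have h1 : (d '' (S.filter fun q => τ q < T)).encard ≤ (k - m : ℕ) := by
    refine (Set.encard_image_le _ _).trans ?_
    rw [Set.encard_coe_eq_coe_finsetCard]
    exact_mod_cast hlt
  refine (add_le_add h1 (present_encard_le hW.full)).trans ?_
  rw [← Nat.cast_add, Nat.sub_add_cancel hmk]

end Agreement

end Run

/-! ### Progress of a single live process. -/

theorem exists_common_bound {P : Fin n → ℕ → Prop} (hmono : ∀ q s t, s ≤ t → P q s → P q t)
    (h : ∀ q, ∃ T, P q T) : ∃ T, ∀ q, P q T := by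
  choose T hT using h
  exact ⟨Finset.univ.sup T, fun q => hmono q _ _ (Finset.le_sup (Finset.mem_univ q)) (hT q)⟩

theorem eventually_const_or_unbounded {f : ℕ → ℕ} (hf : Monotone f) :
    (∃ T, ∀ t, T ≤ t → f t = f T) ∨ ∀ N, ∃ t, N ≤ f t := by
  by_contra! h
  obtain ⟨h1, N, h2⟩ := h
  have : ∀ M, ∃ t, M ≤ f t := by
    intro M
    induction M with
    | zero => exact ⟨0, Nat.zero_le _⟩
    | succ M ih =>
      obtain ⟨t, ht⟩ := ih
      obtain ⟨s, hs1, hs2⟩ := h1 t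
      have := hf hs1
      exact ⟨s, by omega⟩
  obtain ⟨t, ht⟩ := this N
  exact absurd (h2 t) (not_lt.2 ht)

/-- A sequence in `Fin r` that advances by steps of one, infinitely often, reaches each value by
such a step infinitely often. -/
theorem exists_step_to [NeZero r] {f : ℕ → Fin r} (hf : ∀ t, f (t + 1) = f t ∨ f (t + 1) = f t + 1)
    (hinf : ∀ T, ∃ t, T ≤ t ∧ f (t + 1) ≠ f t) (j : Fin r) (T : ℕ) :
    ∃ t, T ≤ t ∧ f (t + 1) ≠ f t ∧ f (t + 1) = j := by
  classical
  have next : ∀ T, ∃ t, T ≤ t ∧ f (t + 1) ≠ f t ∧ f (t + 1) = f T + 1 := by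
    intro T
    have hex : ∃ t, T ≤ t ∧ f (t + 1) ≠ f t := hinf T
    obtain ⟨h1, h2⟩ := Nat.find_spec hex
    refine ⟨Nat.find hex, h1, h2, ?_⟩
    have hconst : ∀ s, T ≤ s → s ≤ Nat.find hex → f s = f T := by
      intro s hs
      induction s, hs using Nat.le_induction with
      | base => exact fun _ => rfl
      | succ s hs ih =>
        intro hs'
        have := Nat.find_min hex (show s < Nat.find hex by omega)
        rw [← ih (by omega)]
        by_contra hne
        exact this ⟨hs, hne⟩
    rw [← hconst _ h1 le_rfl]
    exact (hf _).resolve_left h2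
  have steps : ∀ (d : ℕ) T, ∃ t, T ≤ t ∧ f (t + 1) ≠ f t ∧ f (t + 1) = f T + 1 + Fin.ofNat r d := by
    intro d
    induction d with
    | zero => intro T; simpa using next T
    | succ d ih =>
      intro T
      obtain ⟨t, h1, -, h3⟩ := ih T
      obtain ⟨s, g1, g2, g3⟩ := next (t + 1)
      refine ⟨s, by omega, g2, ?_⟩
      rw [g3, h3, add_assoc]
      congr 1
      apply Fin.ext
      simp [Fin.val_add, Fin.ofNat]
  obtain ⟨t, h1, h2, h3⟩ := steps (j - (f T + 1)).val T
  refine ⟨t, h1, h2, ?_⟩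
  rw [h3]
  have : Fin.ofNat r (j - (f T + 1)).val = j - (f T + 1) := Fin.ext (Nat.mod_eq_of_lt (Fin.isLt _))
  rw [this, add_sub_cancel]

namespace Run

variable {L : Layout n ρ r D} {m : ℕ} [NeZero ρ] [NeZero r] [Nonempty D] {R : Run L m}

/-- `q` takes infinitely many steps. -/
def Live (R : Run L m) (q : Fin n) : Prop := ∀ T, ∃ t, T ≤ t ∧ (R.lab t).proc = some q

/-- From time `T` on, the current operation of `q` is never decided. -/
def StuckFrom (R : Run L m) (q : Fin n) (T : ℕ) : Prop := ∀ t, T ≤ t → (R.st t q).Undecided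

/-- `q` writes infinitely often. -/
def Writes (R : Run L m) (q : Fin n) : Prop := ∀ T, ∃ t, T ≤ t ∧ R.lab t = .write q

theorem StuckFrom.mono {q : Fin n} {S T : ℕ} (h : R.StuckFrom q S) (hST : S ≤ T) :
    R.StuckFrom q T := fun t ht => h t (hST.trans ht)

theorem Writes.live {q : Fin n} (h : R.Writes q) : R.Live q := fun T => by
  obtain ⟨t, h1, h2⟩ := h T
  exact ⟨t, h1, by rw [h2]; rfl⟩

theorem not_invoke_of_undecided {q : Fin n} {t : ℕ} (h : (R.st t q).Undecided) (v : D) :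
    R.lab t ≠ .invoke q v := fun hl => by
  have h1 := (R.invoke t q v hl).1
  rw [(R.undecided_length h).1] at h1
  cases h1

theorem not_respond_of_undecided {q : Fin n} {t : ℕ} (h : (R.st t q).Undecided) (d : D) :
    R.lab t ≠ .respond q d := fun hl => (R.respond t q d hl).2.2.2.1 h

theorem inst_succ_of_not_invoke {q : Fin n} {t : ℕ} (h : ∀ v, R.lab t ≠ .invoke q v) :
    (R.st (t + 1) q).inst = (R.st t q).inst := by
  rcases R.lab_cases t q with hl | ⟨v, hl⟩ | ⟨d, hl⟩ | hl | hl | hl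
  · rw [R.st_frame t q hl]
  · exact absurd hl (h v)
  · rw [(R.respond t q d hl).2.2.1]
  · rw [(R.write t q hl).2.2.2.2.1]; rfl
  · obtain ⟨-, -, -, buf, k, -, -, h6⟩ := R.read t q hl
    rw [h6, (afterRead_fields _ _ _ _ _).2.2.1]
  · obtain ⟨-, -, -, buf, k, -, -, h6⟩ := R.finish t q hl
    rw [h6, (afterScan_fields _ _ _ _).2.2.1]

theorem StuckFrom.inst_eq {q : Fin n} {T : ℕ} (h : R.StuckFrom q T) {s : ℕ} (hs : T ≤ s) :
    (R.st s q).inst = (R.st T q).inst := by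
  induction s, hs using Nat.le_induction with
  | base => rfl
  | succ s hs ih => rw [inst_succ_of_not_invoke (not_invoke_of_undecided (h s hs)), ih]

theorem pos_succ (q : Fin n) (t : ℕ) :
    (R.st (t + 1) q).pos = (R.st t q).pos ∨
      R.lab t = .finish q ∧ (R.st (t + 1) q).pos = (R.st t q).pos + 1 := by
  rcases R.lab_cases t q with hl | ⟨v, hl⟩ | ⟨d, hl⟩ | hl | hl | hl
  · rw [R.st_frame t q hl]; exact .inl rfl
  · rw [(R.invoke t q v hl).2.2]; exact .inl rfl
  · rw [(R.respond t q d hl).2.2.1]; exact .inl rfl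
  · rw [(R.write t q hl).2.2.2.2.1]; exact .inl rfl
  · obtain ⟨-, -, -, buf, k, -, -, h6⟩ := R.read t q hl
    rw [h6, (afterRead_fields _ _ _ _ _).2.2.2.1]; exact .inl rfl
  · obtain ⟨-, -, -, buf, k, -, -, h6⟩ := R.finish t q hl
    rw [h6]
    rcases afterScan_eq_or m q (R.st t q) (L.view buf) with f | f | f
    · exact .inl f.2.1
    · exact .inl f.2.2.1
    · exact .inr ⟨hl, f.2.2.1⟩

theorem exists_finish_of_pos_ne {q : Fin n} {a b : ℕ} (hab : a ≤ b)
    (h : (R.st a q).pos ≠ (R.st b q).pos) : ∃ f, a ≤ f ∧ f < b ∧ R.lab f = .finish q := by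
  induction b, hab using Nat.le_induction with
  | base => exact absurd rfl h
  | succ b hab ih =>
    rcases R.pos_succ q b with h1 | ⟨h1, -⟩
    · rw [h1] at h
      obtain ⟨f, e1, e2, e3⟩ := ih h
      exact ⟨f, e1, by omega, e3⟩
    · exact ⟨b, hab, b.lt_succ_self, h1⟩

/-- A live process whose current operation is not stuck invokes infinitely many operations. -/
theorem Live.stuck_or_unbounded {q : Fin n} (h : R.Live q) :
    (∃ T, R.StuckFrom q T) ∨ ∀ N, ∃ t, N ≤ (R.st t q).inst := by
  rcases eventually_const_or_unbounded (R.inst_mono q) with ⟨T, hT⟩ | hN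
  swap
  · exact .inr hN
  left
  by_contra! hns
  have hni : ∀ t, T ≤ t → ∀ v, R.lab t ≠ .invoke q v := by
    intro t ht v hl
    have h1 := hT (t + 1) (by omega)
    rw [← hT t ht, (R.invoke t q v hl).2.2] at h1
    simp [State.onInvoke] at h1
  obtain ⟨t₁, ht₁, hd⟩ : ∃ t, T ≤ t ∧ ¬ (R.st t q).Undecided := by
    have := hns T
    unfold StuckFrom at this
    push Not at this
    exact this
  have hdec : ∀ t, t₁ ≤ t → ¬ (R.st t q).Undecided := by
    intro t ht hu
    apply hd
    have h1 : (R.st t q).inst = (R.st t₁ q).inst := (hT t (by omega)).trans (hT t₁ ht₁).symm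
    have h2 : (R.st t₁ q).hist.length ≤ (R.st t q).hist.length := R.length_mono q ht
    unfold State.Undecided at hu ⊢
    omega
  -- From `t₁` on the only possible step of `q` is a response, and it can be taken only once; but
  -- `q` is live.
  have hresp : ∀ t, t₁ ≤ t → (R.lab t).proc = some q → R.act t q = true ∧ R.act (t + 1) q = false := by
    intro t ht hp
    rcases R.lab_cases t q with hl | ⟨v, hl⟩ | ⟨d, hl⟩ | hl | hl | hl
    · exact absurd hp hl
    · exact absurd hl (hni t (by omega) v)
    · exact ⟨(R.respond t q d hl).1, (R.respond t q d hl).2.1⟩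
    · exact absurd (R.write t q hl).2.2.1 (hdec t ht)
    · exact absurd (R.read t q hl).2.2.1 (hdec t ht)
    · exact absurd (R.finish t q hl).2.2.1 (hdec t ht)
  obtain ⟨t₂, h1, h2⟩ := h t₁
  have hidle : ∀ t, t₂ + 1 ≤ t → R.act t q = false := by
    intro t ht
    induction t, ht using Nat.le_induction with
    | base => exact (hresp t₂ h1 h2).2
    | succ t ht ih =>
      by_cases hp : (R.lab t).proc = some q
      · exact (hresp t (by omega) hp).2
      · rw [R.act_frame t q hp, ih]
  obtain ⟨t₃, h3, h4⟩ := h (t₂ + 1)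
  have h5 := (hresp t₃ (by omega) h4).1
  rw [hidle t₃ h3] at h5
  cases h5

/-- If all steps of `q` decrease a rank as long as a goal is not reached, the goal is reached. -/
theorem Live.exists_of_rank {q : Fin n} (h : R.Live q) (T : ℕ) (goal : ℕ → Prop) (rank : ℕ → ℕ)
    (hframe : ∀ t, T ≤ t → (R.lab t).proc ≠ some q → rank (t + 1) = rank t)
    (hdec : ∀ t, T ≤ t → (R.lab t).proc = some q → goal t ∨ rank (t + 1) < rank t) :
    ∃ t, T ≤ t ∧ goal t := by
  by_contra! hno
  have hstep : ∀ t, T ≤ t → rank (t + 1) ≤ rank t := by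
    intro t ht
    by_cases hp : (R.lab t).proc = some q
    · exact ((hdec t ht hp).resolve_left (hno t ht)).le
    · exact (hframe t ht hp).le
  have hanti : ∀ s t, T ≤ s → s ≤ t → rank t ≤ rank s := by
    intro s t hs hst
    induction t, hst using Nat.le_induction with
    | base => exact le_rfl
    | succ t hst ih => exact (hstep t (by omega)).trans ih
  have key : ∀ N, ∃ t, T ≤ t ∧ rank t + N ≤ rank T := by
    intro N
    induction N with
    | zero => exact ⟨T, le_rfl, le_rfl⟩
    | succ N ih =>
      obtain ⟨t, h1, h2⟩ := ih
      obtain ⟨s, h3, h4⟩ := h t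
      have h5 := (hdec s (by omega) h4).resolve_left (hno s (by omega))
      have h6 := hanti t s h1 h3
      exact ⟨s + 1, by omega, by omega⟩
  obtain ⟨t, -, ht⟩ := key (rank T + 1)
  omega

/-- A stuck live process reads every register infinitely often, and does not find a decision of
its instance there. -/
theorem Live.exists_read_low {q : Fin n} (h : R.Live q) {T : ℕ} (hs : R.StuckFrom q T)
    (x : Fin ρ) : ∃ t, T ≤ t ∧ (R.reg t x).hist.length < (R.st t q).inst := by
  -- The rank bounds the number of steps of `q` before its next read of `x`. The added `x + 1` pays
  -- for a restart of the scan, `x + 2` for its end and the write that follows.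
  let d : Phase n ρ r D → ℕ := fun ph => match ph with
    | .write => x + 1
    | .scan _ k => if k ≤ x then x - k else if k ≤ x + ρ then x + ρ - k + (x + 1)
      else 2 * ρ - k + (x + 2)
  refine h.exists_of_rank T (fun t => (R.reg t x).hist.length < (R.st t q).inst)
    (fun t => d (R.st t q).phase) (fun t _ hp => by simp only [R.st_frame t q hp]) fun t ht hp => ?_
  have hu := hs t ht
  have hu' := hs (t + 1) (by omega)
  rcases R.lab_cases t q with hl | ⟨v, hl⟩ | ⟨d, hl⟩ | hl | hl | hl
  · exact absurd hp hl
  · exact absurd hl (not_invoke_of_undecided hu v)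
  · exact absurd hl (not_respond_of_undecided hu d)
  · right
    obtain ⟨-, -, -, h4, h5, -⟩ := R.write t q hl
    simp only [h5, h4, d, State.afterWrite]
    simp
  · obtain ⟨-, -, -, buf, k, h4, hk, h6⟩ := R.read t q hl
    have hx := x.isLt
    rcases afterRead_eq_or (R.st t q) buf k (regIndex k) (R.reg t (regIndex k)) with
      ⟨e1, e2⟩ | ⟨e0, e⟩
    · rw [h6, e2] at hu'
      simp only [State.Undecided] at hu'
      omega
    by_cases hkx : k = x
    · left
      have : regIndex k = x := by
        apply Fin.ext; simp [regIndex, Fin.ofNat, hkx, Nat.mod_eq_of_lt hx]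
      rwa [← this]
    by_cases hkx' : k = x + ρ
    · left
      have : regIndex k = x := by
        apply Fin.ext; simp [regIndex, Fin.ofNat, hkx', Nat.mod_eq_of_lt hx]
      rwa [← this]
    right
    rcases e with ⟨e1, e2⟩ | ⟨e1, e2, e3⟩ | ⟨e1, e2, e3⟩
    · rw [h6, e2]
      simp only [h4, d]
      split_ifs <;> omega
    · rw [h6, e3]
      simp only [h4, d]
      split_ifs <;> omega
    · rw [h6, e3]
      simp only [h4, d]
      split_ifs <;> omega
  · right
    obtain ⟨-, -, -, buf, k, h4, hk, h6⟩ := R.finish t q hl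
    have hx := x.isLt
    rw [h6, (afterScan_fields m q (R.st t q) (L.view buf)).2.2.2]
    simp only [h4, d]
    split_ifs <;> omega

/-- A stuck live process writes if the registers do not change. -/
theorem Live.exists_write {q : Fin n} (h : R.Live q) {T : ℕ} (hs : R.StuckFrom q T)
    (hc : ∀ t, T ≤ t → R.reg t = R.reg T) : ∃ t, T ≤ t ∧ R.lab t = .write q := by
  classical
  -- A good scan has collected only the final register contents and never restarts. A scan begun
  -- before `T` may be bad, but it restarts at most once; the summand `2 * ρ + 2` pays for that.
  let good : (Fin ρ → RegVal n r D) → ℕ → Prop := fun b k => ∀ x : Fin ρ, x.val < k → b x = R.reg T x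
  let d : Phase n ρ r D → ℕ := fun ph => match ph with
    | .write => 0
    | .scan b k => if good b k then 2 * ρ - k + 1 else 2 * ρ - k + (2 * ρ + 2)
  refine h.exists_of_rank T (fun t => R.lab t = .write q)
    (fun t => d (R.st t q).phase) (fun t _ hp => by simp only [R.st_frame t q hp]) fun t ht hp => ?_
  have hu := hs t ht
  have hu' := hs (t + 1) (by omega)
  rcases R.lab_cases t q with hl | ⟨v, hl⟩ | ⟨d, hl⟩ | hl | hl | hl
  · exact absurd hp hl
  · exact absurd hl (not_invoke_of_undecided hu v)
  · exact absurd hl (not_respond_of_undecided hu d)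
  · exact .inl hl
  · right
    obtain ⟨-, -, -, buf, k, h4, hk, h6⟩ := R.read t q hl
    have hg0 : ∀ b, good b 0 := fun b x hx => absurd hx (Nat.not_lt_zero _)
    rw [hc t ht] at h6
    rcases afterRead_eq_or (R.st t q) buf k (regIndex k) (R.reg T (regIndex k)) with
      ⟨e1, e2⟩ | ⟨e0, ⟨e1, e2⟩ | ⟨e1, e2, e3⟩ | ⟨e1, e2, e3⟩⟩
    · rw [h6, e2] at hu'
      simp only [State.Undecided] at hu'
      omega
    · have hg : good buf k → good (Function.update buf (regIndex k) (R.reg T (regIndex k))) (k + 1) := by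
        intro hg x hx
        by_cases hxk : x = regIndex k
        · subst hxk; rw [Function.update_self]
        · rw [Function.update_of_ne hxk]
          apply hg
          have : x.val ≠ k := fun hx' => hxk (Fin.ext (hx'.trans (Nat.mod_eq_of_lt e1).symm))
          omega
      rw [h6, e2]
      simp only [h4, d]
      split_ifs with g1 g2
      · omega
      · omega
      · exact absurd (hg ‹_›) g1
      · omega
    · have hg : good buf k → good buf (k + 1) := fun hg x _ => hg x (by omega)
      rw [h6, e3]
      simp only [h4, d]
      split_ifs with g1 g2
      · omega
      · omega
      · exact absurd (hg ‹_›) g1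
      · omega
    · have hng : ¬ good buf k := fun hg => by
        have : (regIndex k : Fin ρ).val < ρ := Fin.isLt _
        exact e2 (hg _ (by omega))
      rw [h6, e3]
      simp only [h4, d, if_pos (hg0 buf), if_neg hng]
      omega
  · right
    obtain ⟨-, -, -, buf, k, h4, hk, h6⟩ := R.finish t q hl
    rw [h6, (afterScan_fields m q (R.st t q) (L.view buf)).2.2.2]
    simp only [h4, d]
    split_ifs <;> omega

end Run

/-! ### All live processes are stuck if one is; settled runs. -/

namespace Run

variable {L : Layout n ρ r D} {m : ℕ} [NeZero ρ] [NeZero r] [Nonempty D] {R : Run L m}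

/-- If all components belong to instance `i`, some register with decisions up to instance `i - 1`
is not written by a set of at most `m` processes in earlier instances, each of them working on a
single component. -/
theorem exists_protected_register [NeZero n] (hL : L.IsDirect ∨ L.IsOwn) (hmr : m < r) {τ i : ℕ}
    (hfull : ∀ j, ∃ u, (R.cell τ j).tup = some u ∧ u.inst = i) {P : Set (Fin n)}
    (hP : P.encard ≤ m) (y : Fin n → Fin r) :
    ∃ x, i ≤ (R.reg τ x).hist.length + 1 ∧
      ∀ q ∈ P, (R.st τ q).inst < i → L.target q (y q) ≠ x := by
  rcases hL with ⟨e, he, ht, hp⟩ | ⟨e, he, ht, hp⟩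
  -- At most `m < r` components are being worked on, so one remains free.
  · obtain ⟨j, hj⟩ : ∃ j, j ∉ y '' P := by
      by_contra! hall
      have h1 : (Set.univ : Set (Fin r)).encard ≤ m :=
        (Set.encard_le_encard fun j _ => hall j).trans ((Set.encard_image_le _ _).trans hP)
      rw [Set.encard_univ, ENat.card_eq_coe_fintype_card, Fintype.card_fin] at h1
      have : r ≤ m := by exact_mod_cast h1
      omega
    obtain ⟨u, h1, rfl⟩ := hfull j
    refine ⟨e j, R.inst_le_length (j := j) ?_, fun q hq _ h => ?_⟩
    · rw [← h1]; simp only [cell, Layout.view, hp]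
    · rw [ht] at h
      exact hj ⟨q, hq, he h⟩
  -- With single-writer registers, the owner of a cell of instance `i` has itself reached instance
  -- `i`, so any component will do.
  · obtain ⟨u, h1, rfl⟩ := hfull 0
    obtain ⟨x, hx⟩ := R.exists_cell_eq τ 0
    rw [hx] at h1
    refine ⟨x, R.inst_le_length h1, fun q _ hq h => ?_⟩
    rw [ht] at h
    subst h
    rw [R.own_reg he.1 ht] at h1
    rcases R.arr_inv τ q 0 with h2 | ⟨u', h2, -, -, -, -, h3⟩
    · rw [h2] at h1; cases h1
    · rw [h2] at h1; cases h1; omega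

/-- A register keeps its decisions as long as it is not written in an earlier instance. -/
theorem length_of_protected {τ i t : ℕ} {x : Fin ρ} (h : i ≤ (R.reg τ x).hist.length + 1)
    (ht : τ ≤ t) (hw : ∀ w q, τ ≤ w → w < t → R.lab w = .write q → (R.st w q).inst < i →
      L.target q (R.st w q).pos ≠ x) : i ≤ (R.reg t x).hist.length + 1 := by
  induction t, ht using Nat.le_induction with
  | base => exact h
  | succ t ht ih =>
    have ih := ih fun w q h1 h2 => hw w q h1 (by omega)
    by_cases hq : ∃ q, R.lab t = .write q
    · obtain ⟨q, hq⟩ := hq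
      obtain ⟨-, -, hu, -, -, h6⟩ := R.write t q hq
      by_cases hx : x = L.target q (R.st t q).pos
      · rw [h6, ← hx, Function.update_self]
        -- A writer in an instance at least `i` brings along at least `i - 1` decisions.
        have h1 := (R.undecided_length hu).2
        have h2 := mt (hw t q ht t.lt_succ_self hq) (not_not.2 hx.symm)
        simp only [newVal]
        omega
      · rw [h6, Function.update_of_ne hx]; exact ih
    · rw [R.reg_frame t (not_exists.1 hq)]; exact ih

/-- If all components belong to instance `i` at time `τ`, then each process works on a single
component as long as it writes in earlier instances. -/
theorem pos_eq_of_low_writes [NeZero n] (hL : L.IsDirect ∨ L.IsOwn) (hmr : m < r) {τ i : ℕ}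
    (hfull : ∀ j, ∃ u, (R.cell τ j).tup = some u ∧ u.inst = i) {P : Set (Fin n)}
    (hP : P.encard ≤ m) (hPw : ∀ t q, τ ≤ t → R.lab t = .write q → q ∈ P) (t : ℕ) :
    ∃ y : Fin n → Fin r, ∀ w q, τ ≤ w → w < t → R.lab w = .write q → (R.st w q).inst < i →
      (R.st w q).pos = y q := by
  classical
  induction t with
  | zero => exact ⟨fun _ => 0, fun w q _ h => absurd h (Nat.not_lt_zero _)⟩
  | succ t ih =>
    obtain ⟨y, hy⟩ := ih
    by_cases hnew : τ ≤ t ∧ ∃ q, R.lab t = .write q ∧ (R.st t q).inst < i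
    swap
    · refine ⟨y, fun w q h1 h2 h3 h4 => ?_⟩
      rcases Nat.lt_succ_iff_lt_or_eq.1 h2 with h2 | rfl
      · exact hy w q h1 h2 h3 h4
      · exact absurd ⟨h1, q, h3, h4⟩ hnew
    obtain ⟨ht, q, hq, hqi⟩ := hnew
    refine ⟨Function.update y q (R.st t q).pos, fun w p h1 h2 h3 h4 => ?_⟩
    rcases Nat.lt_succ_iff_lt_or_eq.1 h2 with h2 | rfl
    swap
    · rw [hq] at h3
      cases h3
      rw [Function.update_self]
    by_cases hpq : p = q
    swap
    · rw [Function.update_of_ne hpq]; exact hy w p h1 h2 h3 h4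
    subst hpq
    rw [Function.update_self]
    by_contra hne
    -- A change of position needs a completed scan after the write at `w`; its snapshot would have
    -- met a decision of its own instance in the protected register.
    obtain ⟨f, f1, f2, f3⟩ := exists_finish_of_pos_ne h2.le hne
    obtain ⟨τ', g1, g2, g3, -⟩ := R.exists_snapshot f3
    have hwτ : w < τ' := by
      by_contra hle
      exact g2.not_write (not_lt.1 hle) f1 h3
    obtain ⟨x, hx1, hx2⟩ := exists_protected_register hL hmr hfull hP y
    have h5 := length_of_protected hx1 (t := τ') (by omega) fun w' q' e1 e2 e3 e4 => by
      rw [hy w' q' e1 (by omega) e3 e4]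
      exact hx2 q' (hPw w' q' e1 e3) ((R.inst_mono q' e1).trans_lt e4)
    have h6 := g3 x
    have h7 : (R.st f p).inst ≤ (R.st t p).inst := R.inst_mono p f2.le
    omega

/-- If a live process is stuck, then all live processes are. -/
theorem Live.exists_stuckFrom [NeZero n] (hL : L.IsDirect ∨ L.IsOwn) (hmr : m < r)
    (hP : {q | R.Live q}.encard ≤ m) {p : Fin n} (hp : R.Live p) {T : ℕ} (hs : R.StuckFrom p T)
    {q : Fin n} (hq : R.Live q) : ∃ S, R.StuckFrom q S := by
  classical
  refine hq.stuck_or_unbounded.resolve_right fun hunb => ?_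
  obtain ⟨T₁, hT₁⟩ : ∃ T, ∀ q, ¬ R.Live q → ∀ t, T ≤ t → (R.lab t).proc ≠ some q := by
    refine exists_common_bound (fun q s t hst h hq u hu => h hq u (hst.trans hu)) fun q => ?_
    by_cases hq : R.Live q
    · exact ⟨0, fun h => absurd hq h⟩
    · unfold Live at hq
      push Not at hq
      obtain ⟨T, hT⟩ := hq
      exact ⟨T, fun _ => hT⟩
  let T₀ := max T T₁
  -- No process has reached `i` at `T₀`, so the snapshot behind any decision in instance `i` is
  -- taken after only live processes move.
  let i := Finset.univ.sup (fun q => (R.st T₀ q).inst) + 1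
  have hi : ∀ q, (R.st T₀ q).inst < i := fun q =>
    Nat.lt_succ_of_le (Finset.le_sup (f := fun q => (R.st T₀ q).inst) (Finset.mem_univ q))
  obtain ⟨s, hsq⟩ := hunb (i + 1)
  have hlen : i ≤ (R.st s q).hist.length := by
    have h1 := R.act_inv s q
    cases ha : R.act s q with
    | true => have := h1.1 ha; omega
    | false => have := h1.2 ha; omega
  obtain ⟨t, z, hdec⟩ := R.hist_subset_dec s q (i - 1) _
    (List.getElem?_eq_getElem (by omega : i - 1 < (R.st s q).hist.length))
  have hi1 : i - 1 + 1 = i := by omega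
  rw [hi1] at hdec
  obtain ⟨τ, h1, h2, h3, h4, -⟩ := hdec.snapshot hmr
  have hτ : T₀ ≤ τ := by
    by_contra hlt
    have h5 : (R.st τ z).inst ≤ (R.st T₀ z).inst := R.inst_mono z (by omega)
    have h6 := (h2 τ le_rfl h1).2.2.1
    have h7 := hdec.2.1
    have h8 := hi z
    omega
  have hPw : ∀ t q, τ ≤ t → R.lab t = .write q → q ∈ {q | R.Live q} := by
    intro t q ht hw
    by_contra hnl
    exact hT₁ q hnl t (by omega) (by rw [hw]; rfl)
  -- `pos_eq_of_low_writes` gives positions up to a time bound only. A choice independent of the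
  -- bound is the position at some fixed low write of each process.
  obtain ⟨y, hy⟩ : ∃ y : Fin n → Fin r, ∀ w q, τ ≤ w → R.lab w = .write q →
      (R.st w q).inst < i → (R.st w q).pos = y q := by
    refine ⟨fun q => if h : ∃ w, τ ≤ w ∧ R.lab w = .write q ∧ (R.st w q).inst < i then
      (R.st h.choose q).pos else 0, fun w q e1 e2 e3 => ?_⟩
    have hex : ∃ w, τ ≤ w ∧ R.lab w = .write q ∧ (R.st w q).inst < i := ⟨w, e1, e2, e3⟩
    simp only [dif_pos hex]
    obtain ⟨c1, c2, c3⟩ := hex.choose_spec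
    obtain ⟨y, hy⟩ := pos_eq_of_low_writes hL hmr h4.1 hP hPw (max w hex.choose + 1)
    rw [hy w q e1 (by omega) e2 e3, hy _ q c1 (by omega) c2 c3]
  obtain ⟨x, hx1, hx2⟩ := exists_protected_register hL hmr h4.1 hP y
  -- The stuck process reads the protected register and should find its decision there.
  obtain ⟨t', ht', hlow⟩ := hp.exists_read_low (hs.mono (show T ≤ τ by omega)) x
  have h5 := length_of_protected hx1 ht' fun w q e1 e2 e3 e4 => by
    rw [hy w q e1 e3 e4]
    exact hx2 q (hPw w q e1 e3) ((R.inst_mono q e1).trans_lt e4)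
  have h6 := hs.inst_eq (show T ≤ t' by omega)
  have h7 : (R.st T p).inst ≤ (R.st T₀ p).inst := R.inst_mono p (le_max_left _ _)
  have h8 := hi p
  omega

/-- From `T` on, only live processes take steps, all of them are stuck, and those that write do so
infinitely often. -/
structure Settled (R : Run L m) (T : ℕ) : Prop where
  live : ∀ t q, T ≤ t → (R.lab t).proc = some q → R.Live q
  stuck : ∀ q, R.Live q → R.StuckFrom q T
  writes : ∀ t q, T ≤ t → R.lab t = .write q → R.Writes q

theorem exists_settled (hall : ∀ q, R.Live q → ∃ S, R.StuckFrom q S) : ∃ T, R.Settled T := by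
  obtain ⟨T, hT⟩ : ∃ T, ∀ q, (∀ t, T ≤ t → (R.lab t).proc = some q → R.Live q) ∧
      (R.Live q → R.StuckFrom q T) ∧ ∀ t, T ≤ t → R.lab t = .write q → R.Writes q := by
    refine exists_common_bound (fun q s t hst h => ⟨fun u hu => h.1 u (hst.trans hu),
      fun hq => (h.2.1 hq).mono hst, fun u hu => h.2.2 u (hst.trans hu)⟩) fun q => ?_
    obtain ⟨T₁, h1⟩ : ∃ T, ∀ t, T ≤ t → (R.lab t).proc = some q → R.Live q := by
      by_cases hq : R.Live q
      · exact ⟨0, fun _ _ _ => hq⟩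
      · have hq' := hq
        unfold Live at hq'
        push Not at hq'
        obtain ⟨T, hT⟩ := hq'
        exact ⟨T, fun t ht h => absurd h (hT t ht)⟩
    obtain ⟨T₂, h2⟩ : ∃ T, R.Live q → R.StuckFrom q T := by
      by_cases hq : R.Live q
      · exact (hall q hq).imp fun _ h _ => h
      · exact ⟨0, fun h => absurd h hq⟩
    obtain ⟨T₃, h3⟩ : ∃ T, ∀ t, T ≤ t → R.lab t = .write q → R.Writes q := by
      by_cases hq : R.Writes q
      · exact ⟨0, fun _ _ _ => hq⟩
      · have hq' := hq
        unfold Writes at hq'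
        push Not at hq'
        obtain ⟨T, hT⟩ := hq'
        exact ⟨T, fun t ht h => absurd h (hT t ht)⟩
    exact ⟨max T₁ (max T₂ T₃), fun t ht => h1 t (by omega), fun hq => (h2 hq).mono (by omega),
      fun t ht => h3 t (by omega)⟩
  exact ⟨T, fun t q => (hT q).1 t, fun q => (hT q).2.1, fun t q => (hT q).2.2 t⟩

namespace Settled

variable {T : ℕ}

theorem mono (h : R.Settled T) {S : ℕ} (hS : T ≤ S) : R.Settled S :=
  ⟨fun t q ht => h.live t q (hS.trans ht), fun q hq => (h.stuck q hq).mono hS,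
    fun t q ht => h.writes t q (hS.trans ht)⟩

/-- Without writers the registers no longer change, a double collect succeeds, and a write follows.
-/
theorem exists_writes (h : R.Settled T) {p : Fin n} (hp : R.Live p) : ∃ q, R.Writes q := by
  by_contra! hno
  have hnw : ∀ t, T ≤ t → ∀ q, R.lab t ≠ .write q := fun t ht q hl => hno q (h.writes t q ht hl)
  obtain ⟨t, ht, hl⟩ := hp.exists_write (h.stuck p hp) fun t ht => by
    induction t, ht using Nat.le_induction with
    | base => rfl
    | succ t ht ih => rw [R.reg_frame t (hnw t ht), ih]
  exact hnw t ht p hl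

theorem not_invoke (h : R.Settled T) {t : ℕ} (ht : T ≤ t) (q : Fin n) (v : D) :
    R.lab t ≠ .invoke q v := fun hl =>
  not_invoke_of_undecided (h.stuck q (h.live t q ht (by rw [hl]; rfl)) t ht) v hl

/-- No invocations occur any more, and when no tuple is bad, advancing is harmless. The conclusion
is that each writer accounts for at most one tuple outside its scans as well. -/
theorem steady [NeZero n] (hL : L.IsDirect ∨ L.IsOwn) (h : R.Settled T) (q : Fin n) {t : ℕ}
    (ht : T ≤ t) : R.Steady (fun _ => False) T t q := by
  induction t, ht using Nat.le_induction with
  | base => exact steady_self _ _ _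
  | succ t ht ih => exact ih.succ hL (h.not_invoke ht q) fun _ _ _ _ _ _ hf => hf.elim

/-- After a write, the scan of a writer ends. -/
theorem exists_finish (h : R.Settled T) {q : Fin n} (hq : R.Writes q) {w : ℕ} (hw : T ≤ w)
    (hl : R.lab w = .write q) : ∃ f, w < f ∧ R.lab f = .finish q ∧ R.Scanning q (w + 1) f := by
  classical
  have hu := h.stuck q hq.live
  have key : ∀ s, w + 1 ≤ s → (∀ f, w < f → f < s → R.lab f ≠ .finish q) →
      R.Scanning q (w + 1) s := by
    intro s hs
    induction s, hs using Nat.le_induction with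
    | base =>
      intro _ s hs1 hs2
      obtain rfl := le_antisymm hs2 hs1
      refine ⟨?_, hu _ (by omega), rfl, rfl, rfl⟩
      rw [(R.write w q hl).2.2.2.2.1]
      exact ⟨_, _, rfl⟩
    | succ s hs ih =>
      intro hnf
      have ih := ih fun f h1 h2 => hnf f h1 (by omega)
      have hsc := ih s hs le_rfl
      rcases R.lab_cases s q with hl | ⟨v, hl⟩ | ⟨d, hl⟩ | hl | hl | hl
      · have hst := R.st_frame s q hl
        exact ih.succ (hst ▸ hsc.1) (hu _ (by omega)) (by rw [hst]) (by rw [hst]) (by rw [hst])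
      · exact absurd hl (not_invoke_of_undecided hsc.2.1 v)
      · exact absurd hl (not_respond_of_undecided hsc.2.1 d)
      · exact absurd hl (ih.not_write hs le_rfl)
      · obtain ⟨-, -, -, buf, k, h4, -, h6⟩ := R.read s q hl
        obtain ⟨-, -, f1, f2, f3, -⟩ := afterRead_fields (R.st s q) buf k (regIndex k)
          (R.reg s (regIndex k))
        rw [← h6] at f1 f2 f3
        refine ih.succ ?_ (hu _ (by omega)) f1 f2 f3
        rw [h6]
        unfold afterRead
        split_ifs
        · exact ⟨_, _, h4⟩
        all_goals exact ⟨_, _, rfl⟩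
      · exact absurd hl (hnf s (by omega) s.lt_succ_self)
  -- Otherwise `q` would scan forever and never write again.
  have hex : ∃ f, w < f ∧ R.lab f = .finish q := by
    by_contra! hno
    obtain ⟨w', h1, h2⟩ := hq (w + 1)
    exact (key w' h1 fun f hf _ => hno f hf).not_write h1 le_rfl h2
  obtain ⟨h1, h2⟩ := Nat.find_spec hex
  exact ⟨Nat.find hex, h1, h2, key _ h1 fun f hf1 hf2 hf3 => Nat.find_min hex hf2 ⟨hf1, hf3⟩⟩

/-- After the end of a scan, the next step is a write. -/
theorem exists_write_after (h : R.Settled T) {q : Fin n} (hq : R.Live q) {f : ℕ} (hf : T ≤ f)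
    (hl : R.lab f = .finish q) : ∃ w, f < w ∧ R.lab w = .write q ∧ R.st w q = R.st (f + 1) q := by
  classical
  have hex := hq (f + 1)
  obtain ⟨h1, h2⟩ := Nat.find_spec hex
  have hconst : ∀ s, f + 1 ≤ s → s ≤ Nat.find hex → R.st s q = R.st (f + 1) q := by
    intro s hs
    induction s, hs using Nat.le_induction with
    | base => exact fun _ => rfl
    | succ s hs ih =>
      intro hs'
      rw [← ih (by omega)]
      exact R.st_frame s q fun hp => Nat.find_min hex hs' ⟨hs, hp⟩
  have hst := hconst _ h1 le_rfl
  have hu : (R.st (Nat.find hex) q).Undecided := h.stuck q hq _ (by omega)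
  refine ⟨Nat.find hex, h1, ?_, hst⟩
  have hph : (R.st (Nat.find hex) q).phase = .write := by
    obtain ⟨-, -, -, buf, k, -, -, h6⟩ := R.finish f q hl
    rw [hst, h6, (afterScan_fields _ _ _ _).2.2.2]
  rcases R.lab_cases (Nat.find hex) q with hl | ⟨v, hl⟩ | ⟨d, hl⟩ | hl | hl | hl
  · exact absurd h2 hl
  · exact absurd hl (not_invoke_of_undecided hu v)
  · exact absurd hl (not_respond_of_undecided hu d)
  · exact hl
  · obtain ⟨-, -, -, buf, k, h4, -⟩ := R.read _ q hl
    rw [hph] at h4; cases h4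
  · obtain ⟨-, -, -, buf, k, h4, -⟩ := R.finish _ q hl
    rw [hph] at h4; cases h4

/-- A snapshot never leads to a decision. -/
theorem snapshot (h : R.Settled T) [NeZero n] {q : Fin n} {f : ℕ} (hf : T ≤ f)
    (hl : R.lab f = .finish q) :
    ∃ τ ≤ f, R.Scanning q τ f ∧ (∀ x, (R.reg τ x).hist.length < (R.st f q).inst) ∧
      (R.st (f + 1) q).stamp = (R.st f q).stamp + ∑ j, (R.cell τ j).stamp ∧
      ¬ Full m (R.st f q).inst (R.cell τ) ∧
      (Adopts q (R.st f q) (R.cell τ) ∧ (R.st (f + 1) q).pos = (R.st f q).pos ∧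
          (R.st (f + 1) q).pref ∈ dupSet (R.cell τ) (R.st f q).inst ∨
        ¬ Adopts q (R.st f q) (R.cell τ) ∧ (R.st (f + 1) q).pos = (R.st f q).pos + 1) := by
  obtain ⟨τ, h1, h2, h3, h4⟩ := R.exists_snapshot hl
  have hq := h.live f q hf (by rw [hl]; rfl)
  refine ⟨τ, h1, h2, h3, by rw [h4, (afterScan_fields _ _ _ _).2.1], ?_⟩
  have hu := h.stuck q hq (f + 1) (by omega)
  rw [h4] at hu ⊢
  rcases afterScan_eq_or m q (R.st f q) (R.cell τ) with g | g | g
  · unfold State.Undecided at hu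
    have h5 := (R.undecided_length (h.stuck q hq f hf)).2
    rw [g.2.2.2, (afterScan_fields _ _ _ _).2.2.1, List.length_append, List.length_singleton] at hu
    omega
  · exact ⟨g.1, .inl ⟨g.2.1, g.2.2.1, g.2.2.2.1⟩⟩
  · exact ⟨g.1, .inr ⟨g.2.1, g.2.2.1⟩⟩

end Settled

theorem Fresh.mono {S T t : ℕ} {j : Fin r} {q : Fin n} {w : ℕ} (h : R.Fresh T t j q w)
    (hS : S ≤ T) : R.Fresh S t j q w := ⟨hS.trans h.1, h.2⟩

/-- A component once rewritten since `T` remains so; only the writer may change. -/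
theorem Fresh.later [NeZero n] (hL : L.IsDirect ∨ L.IsOwn) {T t : ℕ} {j : Fin r} {q : Fin n}
    {w : ℕ} (h : R.Fresh T t j q w) {s : ℕ} (hs : t ≤ s) : ∃ q' w', R.Fresh T s j q' w' := by
  have hTt : T ≤ t := by have := h.1; have := h.2.1; omega
  rcases R.cell_const_or_fresh hL t s hs j with h1 | ⟨q', w', h1⟩
  · refine ⟨q, w, h.1, h.2.1.trans_le hs, h.2.2.1, h.2.2.2.1, fun a ha1 ha2 => ?_⟩
    rcases Nat.lt_or_ge a t with hat | hat
    · exact h.2.2.2.2 a ha1 hat.le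
    · rw [h1 a hat ha2, h.cell_eq]
  · exact ⟨q', w', h1.mono hTt⟩

/-- The component written after a snapshot has changed since the snapshot. -/
theorem Settled.fresh_of_finish [NeZero n] (hL : L.IsDirect ∨ L.IsOwn) {T : ℕ} (h : R.Settled T)
    {q : Fin n} (hq : R.Live q) {w₀ f : ℕ} (hw₀ : T ≤ w₀) (hl₀ : R.lab w₀ = .write q)
    (hf : w₀ < f) (hl : R.lab f = .finish q) :
    ∃ t₀, ∀ t, t₀ ≤ t → ∃ q' w', R.Fresh T t (R.st (f + 1) q).pos q' w' := by
  obtain ⟨w, h1, h2, h3⟩ := h.exists_write_after hq (hw₀.trans hf.le) hl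
  obtain ⟨τ, g1, g2, -, g4, -⟩ := h.snapshot (hw₀.trans hf.le) hl
  have hτ : T ≤ τ := by
    by_contra hlt
    exact g2.not_write (show τ ≤ w₀ by omega) hf.le hl₀
  suffices hs : ∃ q' w', R.Fresh T (w + 1) (R.st (f + 1) q).pos q' w' by
    obtain ⟨q', w', hs⟩ := hs
    exact ⟨w + 1, fun t ht => hs.later hL ht⟩
  have hc := (R.cell_write hL h2).2
  rw [← h3]
  rcases hc with hc | ⟨hc, -, hst⟩
  · refine ⟨q, w, by omega, w.lt_succ_self, h2, rfl, fun s hs1 hs2 => ?_⟩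
    rw [le_antisymm hs2 hs1, hc]
  -- The stamp of the write exceeds all stamps of the snapshot. If the write is nevertheless lost,
  -- the winning cell was written after the snapshot.
  · rcases R.cell_const_or_fresh hL τ (w + 1) (by omega) (R.st w q).pos with h5 | ⟨q', w', h5⟩
    · exfalso
      have h6 := h5 (w + 1) (by omega) le_rfl
      rw [← hc, h6] at hst
      have h7 := newStamp_gt q (R.st w q)
      have h8 : (R.cell τ (R.st w q).pos).stamp ≤ ∑ j, (R.cell τ j).stamp :=
        Finset.single_le_sum (f := fun j => (R.cell τ j).stamp) (fun _ _ => Nat.zero_le _)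
          (Finset.mem_univ _)
      rw [h3] at h7 h8 hst
      omega
    · exact ⟨q', w', h5.mono hτ⟩

end Run

/-! ### Termination: positions can neither advance forever nor come to rest. -/

namespace Run

variable {L : Layout n ρ r D} {m : ℕ} [NeZero ρ] [NeZero r] [Nonempty D] {R : Run L m}

/-- Not all positions can advance forever: a writer in the least instance would see at most `m`
tuples, all of its own instance. -/
theorem Settled.pos_eventually_const [NeZero n] (hL : L.IsDirect ∨ L.IsOwn)
    (hP : {q | R.Live q}.encard ≤ m) {T : ℕ} (h : R.Settled T) {q : Fin n} (hq : R.Writes q) :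
    ∃ S, ∀ t, S ≤ t → (R.st t q).pos = (R.st S q).pos := by
  classical
  by_contra! hno
  have hinf : ∀ S, ∃ t, S ≤ t ∧ (R.st (t + 1) q).pos ≠ (R.st t q).pos := by
    intro S
    by_contra! hc
    obtain ⟨t, h1, h2⟩ := hno S
    apply h2
    clear h2
    induction t, h1 using Nat.le_induction with
    | base => rfl
    | succ t h1 ih => rw [hc t h1, ih]
  obtain ⟨w₀, hw₀, hl₀⟩ := hq T
  have hfresh : ∀ j, ∃ t₀, ∀ t, t₀ ≤ t → ∃ q' w', R.Fresh T t j q' w' := by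
    intro j
    obtain ⟨f, h1, h2, h3⟩ := exists_step_to (f := fun t => (R.st t q).pos)
      (fun t => (R.pos_succ q t).imp_right And.right) hinf j (w₀ + 1)
    have hl := ((R.pos_succ q f).resolve_left h2).1
    rw [← h3]
    exact h.fresh_of_finish hL hq.live hw₀ hl₀ h1 hl
  obtain ⟨t₀, ht₀⟩ := exists_common_bound (P := fun j S => ∀ t, S ≤ t → ∃ q' w', R.Fresh T t j q' w')
    (fun j s t hst h u hu => h u (hst.trans hu)) hfresh
  -- A completed scan sees no later instances, and by minimality no earlier ones: all components
  -- belong to the instance of `q₀`.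
  obtain ⟨q₀, hq₀, hmin⟩ := Set.exists_min_image {q | R.Writes q} (fun q => (R.st T q).inst)
    (Set.toFinite _) ⟨q, hq⟩
  have hq₀ : R.Writes q₀ := hq₀
  obtain ⟨w, hw, hl⟩ := hq₀ (max T t₀)
  obtain ⟨f, hf, hlf, -⟩ := h.exists_finish hq₀ (by omega) hl
  obtain ⟨τ, hτ, hsc, hlow, -, hnf, -⟩ := h.snapshot (by omega) hlf
  have hτw : w < τ := by
    by_contra hle
    exact hsc.not_write (not_lt.1 hle) hf.le hl
  have hinst : ∀ {p : Fin n} {s : ℕ}, R.Writes p → T ≤ s → (R.st s p).inst = (R.st T p).inst :=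
    fun hp hs => (h.stuck _ hp.live).inst_eq hs
  have hcell : ∀ j, ∃ p w', R.Writes p ∧ R.Fresh T τ j p w' := by
    intro j
    obtain ⟨p, w', hf'⟩ := ht₀ j τ (by omega)
    exact ⟨p, w', h.writes w' p hf'.1 hf'.2.2.1, hf'⟩
  apply hnf
  constructor
  · intro j
    obtain ⟨p, w', hp, hf'⟩ := hcell j
    refine ⟨_, hf'.tup_eq, le_antisymm (R.cell_inst_le hlow hf'.tup_eq) ?_⟩
    rw [hinst hq₀ (by omega)]
    simp only [mine]
    rw [hinst hp hf'.1]
    exact hmin p hp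
  -- `g p` is the only tuple that fresh components of `p` can hold: its current tuple, or the
  -- content of its single component.
  · let g : Fin n → Option (Tuple n D) := fun p =>
      if ∀ j w, R.Fresh T τ j p w → (R.cell τ j).tup = some (mine p (R.st τ p)) then
        some (mine p (R.st τ p)) else (R.cell τ (R.st τ p).pos).tup
    have hsub : (Set.range fun j => (R.cell τ j).tup) ⊆ g '' {q | R.Live q} := by
      rintro _ ⟨j, rfl⟩
      obtain ⟨p, w', hp, hf'⟩ := hcell j
      refine ⟨p, hp.live, ?_⟩
      simp only [g]
      split_ifs with hc
      · exact (hc j w' hf').symm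
      · rcases (h.steady hL p (t := τ) (by omega)).1 with h1 | h1
        · exact absurd h1.1 hc
        · rw [h1 j w' hf']
    have hle := (Set.encard_le_encard hsub).trans ((Set.encard_image_le _ _).trans hP)
    rw [← Set.Finite.cast_ncard_eq (Set.finite_range _)] at hle
    exact_mod_cast hle

/-- Positions cannot be constant forever: the set of duplicated values would be stable. -/
theorem Settled.not_pos_const [NeZero n] (hL : L.IsDirect ∨ L.IsOwn) (hr : 2 ≤ r) {T : ℕ}
    (h : R.Settled T)
    (hpos : ∀ q, R.Writes q → ∀ t, T ≤ t → (R.st t q).pos = (R.st T q).pos) {q : Fin n}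
    (hq : R.Writes q) : False := by
  have hadopt : ∀ {p : Fin n} {f : ℕ}, R.Writes p → T ≤ f → R.lab f = .finish p →
      ∃ τ ≤ f, R.Scanning p τ f ∧ Adopts p (R.st f p) (R.cell τ) ∧
        (R.st (f + 1) p).pref ∈ dupSet (R.cell τ) (R.st f p).inst := by
    intro p f hp hf hl
    obtain ⟨τ, h1, h2, -, -, -, ⟨h3, -, h4⟩ | ⟨-, h3⟩⟩ := h.snapshot hf hl
    · exact ⟨τ, h1, h2, h3, h4⟩
    · exfalso
      rw [hpos p hp f hf, hpos p hp (f + 1) (by omega)] at h3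
      -- An advance without a change of position would mean `1 = 0` in `Fin r`, impossible for `2 ≤
      -- r`.
      have h4 := left_eq_add.1 h3
      have h5 := congrArg Fin.val h4
      rw [Fin.val_one' r, Nat.mod_eq_of_lt (by omega)] at h5
      simp at h5
  have hfp : ∀ {S t : ℕ} {j : Fin r} {p : Fin n} {w : ℕ}, T ≤ S → R.Fresh S t j p w →
      R.Writes p ∧ j = (R.st T p).pos := by
    intro S t j p w hS hf
    have hp := h.writes w p (hS.trans hf.1) hf.2.2.1
    exact ⟨hp, by rw [← hf.2.2.2.1, hpos p hp w (hS.trans hf.1)]⟩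
  obtain ⟨t₀, ht₀⟩ : ∃ t₀, ∀ p, R.Writes p → ∀ t, t₀ ≤ t →
      ∃ q' w', R.Fresh T t (R.st T p).pos q' w' := by
    refine exists_common_bound (fun p s t hst h hp u hu => h hp u (hst.trans hu)) fun p => ?_
    by_cases hp : R.Writes p
    · obtain ⟨w, hw, hl⟩ := hp T
      obtain ⟨f, hf, hlf, -⟩ := h.exists_finish hp hw hl
      obtain ⟨t₀, ht₀⟩ := h.fresh_of_finish hL hp.live hw hl hf hlf
      rw [hpos p hp (f + 1) (by omega)] at ht₀
      exact ⟨t₀, fun _ => ht₀⟩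
    · exact ⟨0, fun h => absurd h hp⟩
  obtain ⟨w, hw, hl⟩ := hq (max T t₀)
  obtain ⟨f₁, hf₁, hl₁, -⟩ := h.exists_finish hq (by omega) hl
  obtain ⟨w₂, hw₂, hlw₂, hst⟩ := h.exists_write_after hq.live (by omega) hl₁
  obtain ⟨f₂, hf₂, hl₂, hsc₂'⟩ := h.exists_finish hq (by omega) hlw₂
  obtain ⟨τ₁, hτ₁, hsc₁, -, hd₁⟩ := hadopt hq (by omega) hl₁
  obtain ⟨τ₂, hτ₂, hsc₂, ha₂, -⟩ := hadopt hq (by omega) hl₂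
  have hwτ₁ : w < τ₁ := by
    by_contra hle
    exact hsc₁.not_write (not_lt.1 hle) hf₁.le hl
  have hwτ₂ : w₂ < τ₂ := by
    by_contra hle
    exact hsc₂.not_write (not_lt.1 hle) hf₂.le hlw₂
  have hpref : (R.st f₂ q).pref = (R.st (f₁ + 1) q).pref := by
    rw [← (hsc₂' (w₂ + 1) le_rfl hf₂).2.2.2.2, (R.write w₂ q hlw₂).2.2.2.2.1, ← hst]
    rfl
  have hinst : (R.st f₂ q).inst = (R.st f₁ q).inst := by
    rw [(h.stuck q hq.live).inst_eq (by omega : T ≤ f₂),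
      (h.stuck q hq.live).inst_eq (by omega : T ≤ f₁)]
  apply ha₂.2.2
  rw [hpref, hinst]
  obtain ⟨j₁, j₂, u, hne, h1, h2, h3, h4⟩ := hd₁
  -- The two components that hold the adopted value do not change before the next snapshot of `q`.
  have key : ∀ {j j' : Fin r}, j ≠ j' → (R.cell τ₁ j).tup = some u →
      (R.cell τ₁ j').tup = some u → R.cell τ₂ j = R.cell τ₁ j := by
    intro j j' hjj hj hj'
    rcases R.cell_const_or_fresh hL τ₁ τ₂ (by omega) j with hc | ⟨p, w', hf⟩
    · exact hc τ₂ (by omega) le_rfl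
    exfalso
    obtain ⟨hp, hjp⟩ := hfp (by omega) hf
    obtain ⟨p₁, w₁, hf₁'⟩ := ht₀ p hp τ₁ (by omega)
    rw [← hjp] at hf₁'
    obtain ⟨hp₁, hjp₁⟩ := hfp le_rfl hf₁'
    have hu : mine p₁ (R.st w₁ p₁) = u := by
      have := hf₁'.tup_eq
      rw [hj] at this
      exact (Option.some.inj this).symm
    -- If `j` changes, it is the position of a writer and its tuple `u` at `τ₁` is recent, written
    -- by `p₁` at `j`. The same tuple in `j'` cannot be recent, as `p₁` writes only to `j`.
    have hnf : ∀ p' w', ¬ R.Fresh T τ₁ j' p' w' := by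
      intro p' w' hf'
      have h5 := hf'.tup_eq
      rw [hj', ← hu] at h5
      simp only [mine, Option.some.injEq, Tuple.mk.injEq] at h5
      obtain ⟨rfl, -⟩ := h5
      exact hjj (hjp₁.trans (hfp le_rfl hf').2.symm)
    -- Hence `j'` is no writer's position and holds `u` throughout.
    have hconst : ∀ t, T ≤ t → R.cell t j' = R.cell T j' := by
      intro t ht
      rcases R.cell_const_or_fresh hL T t ht j' with hc | ⟨p', w', hf'⟩
      · exact hc t ht le_rfl
      · exfalso
        obtain ⟨hp', hjp'⟩ := hfp le_rfl hf'
        obtain ⟨p₃, w₃, hf₃⟩ := ht₀ p' hp' τ₁ (by omega)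
        exact hnf p₃ w₃ (hjp' ▸ hf₃)
    obtain ⟨f, e1, e2, e3⟩ := h.exists_finish hp₁ hf₁'.1 hf₁'.2.2.1
    have hTw := hf₁'.1
    obtain ⟨τ, g1, g2, g3, -⟩ := hadopt hp₁ (by omega) e2
    have hwτ : w₁ < τ := by
      by_contra hle
      exact g2.not_write (not_lt.1 hle) e1.le hf₁'.2.2.1
    -- So `p₁`, in the scan after writing `u`, saw its own tuple in `j'` away from its position, and
    -- could not adopt.
    apply g3.1 j'
    · rw [hpos p₁ hp₁ f (by omega), ← hjp₁]
      exact hjj.symm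
    · rw [hconst τ (by omega), ← hconst τ₁ (by omega), hj', ← hu]
      have e4 := e3 (w₁ + 1) le_rfl e1
      rw [(R.write w₁ p₁ hf₁'.2.2.1).2.2.2.2.1] at e4
      simp only [mine, ← e4.2.2.1, ← e4.2.2.2.2, State.afterWrite]
  exact ⟨j₁, j₂, u, hne, (key hne h1 h2).symm ▸ h1, (key hne.symm h2 h1).symm ▸ h2, h3, h4⟩

/-- If at most `m` processes are live, none of them is stuck. -/
theorem Live.not_stuckFrom [NeZero n] (hL : L.IsDirect ∨ L.IsOwn) (hmr : m < r) (hm : 1 ≤ m)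
    (hP : {q | R.Live q}.encard ≤ m) {p : Fin n} (hp : R.Live p) (T : ℕ) :
    ¬ R.StuckFrom p T := by
  intro hs
  obtain ⟨T₁, h⟩ := exists_settled fun q hq => hp.exists_stuckFrom hL hmr hP hs hq
  obtain ⟨q, hq⟩ := h.exists_writes hp
  obtain ⟨S, hS⟩ : ∃ S, ∀ q, R.Writes q → ∀ t, S ≤ t → (R.st t q).pos = (R.st S q).pos := by
    refine exists_common_bound (fun q s t hst h hq u hu => ?_) fun q => ?_
    · rw [h hq u (hst.trans hu), h hq t hst]
    · by_cases hq : R.Writes q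
      · exact (h.pos_eventually_const hL hP hq).imp fun _ h _ => h
      · exact ⟨0, fun h => absurd h hq⟩
  refine (h.mono (le_max_left T₁ S)).not_pos_const hL (by omega) (fun q hq t ht => ?_) hq
  rw [hS q hq t (by omega), hS q hq (max T₁ S) (by omega)]

end Run

/-! ### From runs back to executions. -/

section Correctness

variable {L : Layout n ρ r D} {m : ℕ} [NeZero ρ] [NeZero r] [Nonempty D]

theorem numInvoked_succ (α : Execution (algorithm L m)) (p : Fin n) (t : ℕ) :
    ((∃ v, α.ev t = .invoke p v) → α.numInvoked p (t + 1) = α.numInvoked p t + 1) ∧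
      ((¬ ∃ v, α.ev t = .invoke p v) → α.numInvoked p (t + 1) = α.numInvoked p t) := by
  unfold Execution.numInvoked
  have hfin : {s : ℕ | s < t ∧ ∃ v, α.ev s = .invoke p v}.Finite :=
    (Set.finite_lt_nat t).subset fun s hs => hs.1
  refine ⟨fun h => ?_, fun h => ?_⟩
  · have : {s : ℕ | s < t + 1 ∧ ∃ v, α.ev s = .invoke p v} =
        insert t {s : ℕ | s < t ∧ ∃ v, α.ev s = .invoke p v} := by
      ext s
      simp only [Set.mem_ofPred_eq, Set.mem_insert_iff, Nat.lt_succ_iff_lt_or_eq]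
      constructor
      · rintro ⟨hs | hs, h'⟩
        · exact .inr ⟨hs, h'⟩
        · exact .inl hs
      · rintro (rfl | ⟨hs, h'⟩)
        · exact ⟨.inr rfl, h⟩
        · exact ⟨.inl hs, h'⟩
    rw [this, Set.ncard_insert_of_notMem (fun hs => absurd hs.1 (lt_irrefl t)) hfin]
  · congr 1
    ext s
    simp only [Set.mem_ofPred_eq, Nat.lt_succ_iff_lt_or_eq]
    constructor
    · rintro ⟨hs | rfl, h'⟩
      · exact ⟨hs, h'⟩
      · exact absurd h' h
    · rintro ⟨hs, h'⟩
      exact ⟨.inl hs, h'⟩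

theorem numInvoked_eq_inst (α : Execution (algorithm L m)) {R : Run L m}
    (hlab : ∀ t : ℕ, (t : ℕ∞) < α.len → (R.lab t).Matches (α.ev t)) (p : Fin n) {t : ℕ}
    (ht : (t : ℕ∞) ≤ α.len) : α.numInvoked p t = (R.st t p).inst := by
  induction t with
  | zero => simp [Execution.numInvoked, R.st_zero]
  | succ t ih =>
    have hlt : (t : ℕ∞) < α.len := lt_of_lt_of_le (by exact_mod_cast t.lt_succ_self) ht
    have ih := ih hlt.le
    obtain ⟨-, hinv, -⟩ := hlab t hlt
    obtain ⟨h1, h2⟩ := numInvoked_succ α p t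
    by_cases h : ∃ v, α.ev t = .invoke p v
    · rw [h1 h, ih]
      obtain ⟨v, hv⟩ := h
      rw [(R.invoke t p v ((hinv p v).1 hv)).2.2]
      rfl
    · rw [h2 h, ih, Run.inst_succ_of_not_invoke fun v hv => h ⟨v, (hinv p v).2 hv⟩]

theorem solvesRepeatedSetAgreement [NeZero n] (hL : L.IsDirect ∨ L.IsOwn) {k : ℕ} (hm : 1 ≤ m)
    (hmk : m ≤ k) (hkn : k < n) (hr : n + 2 * m = r + k) :
    (algorithm L m).SolvesRepeatedSetAgreement k := by
  intro α i _
  obtain ⟨R, -, hlab, hidle⟩ := exists_run α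
  have hout : α.outputs i ⊆ R.dec i := by
    rintro d ⟨p, t, ht, hev, hnum⟩
    obtain ⟨h1, -, -, h4, h5⟩ := R.respond t p d (((hlab t ht).2.2 p d).1 hev)
    rw [numInvoked_eq_inst α hlab p ht.le] at hnum
    have h6 := (R.act_inv t p).1 h1
    simp only [State.Undecided, not_lt] at h4
    have h7 : (R.st t p).inst - 1 < (R.st t p).hist.length := by omega
    have h8 := R.hist_subset_dec t p ((R.st t p).inst - 1) d (by
      rw [h5, List.getD_eq_getElem _ _ h7, List.getElem?_eq_getElem h7])
    rwa [Nat.sub_add_cancel h6.1, hnum] at h8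
  refine ⟨fun d hd => ?_, (Set.encard_le_encard hout).trans
    (R.dec_encard_le hL k hm hmk hkn hr i)⟩
  obtain ⟨t, p, h1, h2⟩ := R.dec_subset_inp (by omega) i (hout hd)
  have ht : (t : ℕ∞) < α.len := by
    by_contra hnt
    rw [hidle t hnt] at h1
    cases h1
  exact ⟨p, t, ht, ((hlab t ht).2.1 p d).2 h1, by rw [numInvoked_eq_inst α hlab p ht.le, h2]⟩

theorem obstructionFree [NeZero n] (hL : L.IsDirect ∨ L.IsOwn) (hmr : m < r) (hm : 1 ≤ m) :
    (algorithm L m).ObstructionFree m := by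
  intro α hinf p hcorr t v ht hev
  obtain ⟨R, hconf, hlab, hidle⟩ := exists_run α
  have hlive : ∀ q, R.Live q ↔ α.TakesInfinitelyManySteps q := by
    refine fun q => forall_congr' fun T => exists_congr fun s => and_congr_right fun _ => ?_
    by_cases hs : (s : ℕ∞) < α.len
    · simp [(hlab s hs).1, hs]
    · simp [hidle s hs, hs, Label.proc]
  by_contra! hno
  have hnr : ∀ s d, t < s → R.lab s ≠ .respond p d := by
    intro s d hts hl
    by_cases hs : (s : ℕ∞) < α.len
    · exact hno s d hts hs (((hlab s hs).2.2 p d).2 hl)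
    · rw [hidle s hs] at hl
      cases hl
  have hact : ∀ s, t + 1 ≤ s → R.act s p = true := by
    intro s hs
    induction s, hs using Nat.le_induction with
    | base => exact (R.invoke t p v (((hlab t ht).2.1 p v).1 hev)).2.1
    | succ s hs ih =>
      rcases R.lab_cases s p with hl | ⟨v, hl⟩ | ⟨d, hl⟩ | hl | hl | hl
      · rw [R.act_frame s p hl, ih]
      · exact (R.invoke s p v hl).2.1
      · exact absurd hl (hnr s d (by omega))
      · exact (R.write s p hl).2.1
      · exact (R.read s p hl).2.1
      · exact (R.finish s p hl).2.1
  rcases hcorr with hcorr | ⟨T, hT, hidleT⟩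
  · have hp := (hlive p).2 hcorr
    have hP : {q | R.Live q}.encard ≤ m := by simpa only [hlive] using hinf
    refine hp.not_stuckFrom hL hmr hm hP (t + 1) fun s hs => ?_
    by_contra hd
    -- Once the instance is decided, the only possible step of the active process `p` is its
    -- response.
    have hni : ∀ u, s ≤ u → ∀ v, R.lab u ≠ .invoke p v := by
      intro u hu v hl
      have h1 := (R.invoke u p v hl).1
      rw [hact u (by omega)] at h1
      cases h1
    have hinst : ∀ u, s ≤ u → (R.st u p).inst = (R.st s p).inst := by
      intro u hu
      induction u, hu using Nat.le_induction with
      | base => rfl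
      | succ u hu ih => rw [Run.inst_succ_of_not_invoke (hni u hu), ih]
    have hdec : ∀ u, s ≤ u → ¬ (R.st u p).Undecided := by
      intro u hu
      have h1 := hinst u hu
      have h2 : (R.st s p).hist.length ≤ (R.st u p).hist.length := R.length_mono p hu
      unfold State.Undecided at hd ⊢
      omega
    obtain ⟨u, hu, hpu⟩ := hp s
    rcases R.lab_cases u p with hl | ⟨v, hl⟩ | ⟨d, hl⟩ | hl | hl | hl
    · exact hl hpu
    · exact hni u hu v hl
    · exact hnr u d (by omega) hl
    · exact hdec u hu (R.write u p hl).2.2.1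
    · exact hdec u hu (R.read u p hl).2.2.1
    · exact hdec u hu (R.finish u p hl).2.2.1
  · have h1 : ((max T (t + 1) : ℕ) : ℕ∞) ≤ α.len := by
      rcases max_choice T (t + 1) with h | h <;> rw [h]
      · exact hT
      · simpa using Order.add_one_le_of_lt ht
    have h2 := hidleT _ (le_max_left _ _) h1
    rw [← (hconf _ h1).1, hact _ (le_max_right _ _)] at h2
    cases h2

end Correctness

/-! ### The two layouts and the theorem. -/

/-- One register for each component. -/
def directLayout (n r : ℕ) (D : Type u) : Layout n r r D := ⟨fun _ j => j, fun j _ => j⟩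

theorem directLayout_isDirect (n r : ℕ) (D : Type u) : (directLayout n r D).IsDirect :=
  ⟨id, Function.injective_id, fun _ _ => rfl, fun _ _ => rfl⟩

theorem exists_max_stamp [NeZero n] (f : Fin n → Cell n D) : ∃ y, ∀ x, (f x).stamp ≤ (f y).stamp :=
  Finite.exists_max fun x => (f x).stamp

/-- One register for each process. -/
noncomputable def ownLayout (n r : ℕ) [NeZero n] (D : Type u) : Layout n n r D :=
  ⟨fun p _ => p, fun _ f => (exists_max_stamp f).choose⟩

theorem ownLayout_isOwn (n r : ℕ) [NeZero n] (D : Type u) : (ownLayout n r D).IsOwn :=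
  ⟨id, Function.bijective_id, fun _ _ => rfl, fun _ f => (exists_max_stamp f).choose_spec⟩

/-- If there are no input values, no operation is ever invoked. -/
theorem exists_algorithm_of_isEmpty [IsEmpty D] (n r m k : ℕ) :
    ∃ A : Algorithm n r D, A.SolvesRepeatedSetAgreement k ∧ A.ObstructionFree m := by
  refine ⟨⟨PUnit, PUnit, fun _ => ⟨⟩, fun _ => ⟨⟩, fun _ _ _ => ⟨⟩, fun _ _ => .compute ⟨⟩⟩,
    fun α i _ => ⟨fun d => isEmptyElim d, ?_⟩, fun α _ p _ t v => isEmptyElim v⟩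
  rw [Set.eq_empty_of_isEmpty (α.outputs i)]
  simp

end SetAgreement
end SharedMemory

theorem theorem3 (n m k : ℕ) (hm : 1 ≤ m) (hmk : m ≤ k) (hkn : k < n) (D : Type u) :
    ∃ A : SharedMemory.Algorithm n (min (n + 2 * m - k) n) D,
      A.SolvesRepeatedSetAgreement k ∧ A.ObstructionFree m := by
  open SharedMemory.SetAgreement in
  rcases isEmpty_or_nonempty D with hD | hD
  · exact exists_algorithm_of_isEmpty _ _ _ _
  have : NeZero n := ⟨by omega⟩
  -- The subtraction does not truncate, as `k < n`.
  have hr : n + 2 * m = (n + 2 * m - k) + k := by omega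
  generalize n + 2 * m - k = r at hr
  have : NeZero r := ⟨by omega⟩
  rcases le_total r n with h | h
  · rw [min_eq_left h]
    have hL := directLayout_isDirect n r D
    exact ⟨algorithm (directLayout n r D) m,
      solvesRepeatedSetAgreement (.inl hL) hm hmk hkn hr, obstructionFree (.inl hL) (by omega) hm⟩
  · rw [min_eq_right h]
    have hL := ownLayout_isOwn n r D
    exact ⟨algorithm (ownLayout n r D) m,
      solvesRepeatedSetAgreement (.inr hL) hm hmk hkn hr, obstructionFree (.inr hL) (by omega) hm⟩
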